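/- **Model.** Time is slotted. A *zero-wait sensor* with positive integer service times $S_0,S_1,\dots$ generates its update $i$ at time $G_i=\sum_{j<i}S_j$, and this update is served (received by the monitor) at slot $G_i+S_i=G_{i+1}$. If one or several such sensors report to a monitor, the age of information (AoI) starts from some $\Delta[0]=\delta_0\in\mathbb N$ and evolves as $$\Delta[t+1]=\min\bigl(\{\Delta[t]+1\}\cup\{t-G+1:\ \text{an update generated at time } G \text{ is served at slot } t\}\bigr).$$ An update served at slot $t$ with $t-G<\Delta[t]$ is *valid* (of two updates served in the same slot at most one counts as valid); $\Delta[t]$ is then an age peak. The average AoI and the average peak AoI (PAoI) of a system are $$\overline\Delta=\lim_{n\to\infty}\frac1n\sum_{t<n}\mathbb E\,\Delta[t],\qquad \overline\Delta^{\mathrm p}=\lim_{n\to\infty}\frac{\mathbb E[\text{sum of the age peaks in slots }0,\dots,n-1]}{\mathbb E[\text{number of valid updates in slots }0,\dots,n-1]}.$$ For $p\in(0,1)$ and $T\in\mathbb N$, $T\ge2$: ZW/Geo/1 is a single zero-wait sensor with i.i.d. service times, $\mathbb P(S_i=k)=p(1-p)^{k-1}$ for $k\ge1$ (service rate $p$);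 ZW/D/1 is a single zero-wait sensor with constant service time $T$ (service rate $1/T$); the Geo-D system consists of one sensor of each kind in parallel. Take equal service rates $p=1/T=\mu$, and for $\psi\in\{\text{ZW/Geo/1},\text{ZW/D/1}\}$ put $$\eta_\psi=\frac{\overline\Delta_\psi-\overline\Delta_{\text{Geo-D}}}{\overline\Delta_\psi},\qquad \eta^{\mathrm p}_\psi=\frac{\overline\Delta^{\mathrm p}_\psi-\overline\Delta^{\mathrm p}_{\text{Geo-D}}}{\overline\Delta^{\mathrm p}_\psi}.$$ **Statement.** For every $\delta_0$ and every $\mu=1/T$ with $T\ge 2$, all these averages exist (the expectations are those of integrable variables and the long-run limits exist). As $\mu=1/T\to0$ (that is, $T\to\infty$), $$\eta_{\text{ZW/Geo/1}}\to\frac2e-\frac5{2e^2}\approx 0.3974,\qquad \eta_{\text{ZW/D/1}}\to\frac8{3e}-\frac{10}{3e^2}-\frac13\approx0.1965,$$ $$\eta^{\mathrm p}_{\text{ZW/Geo/1}}\to\frac{3e-2}{2(e^2+e+1)}\approx0.2771,\qquad \eta^{\mathrm p}_{\text{ZW/D/1}}\to\frac{3e-2}{2(e^2+e+1)}\approx0.2771,$$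 where each decimal approximation has error less than $10^{-4}$. -/

import Mathlib

open MeasureTheory ProbabilityTheory Filter Topology

noncomputable section

/-! Time is slotted.  A zero-wait sensor is described by the sequence `s` of the (positive) service
times of its updates: update `i + 1` is generated at the moment update `i` is served, and update `0`
is generated at time `0`. -/

/-- Generation time of the `i`-th update of a zero-wait sensor with service times `s`. -/
def genTime (s : ℕ → ℕ) (i : ℕ) : ℕ := ∑ j ∈ Finset.range i, s j

/-- The slot at which the `i`-th update of a zero-wait sensor is served (received). -/
def servedTime (s : ℕ → ℕ) (i : ℕ) : ℕ := genTime s i + s i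

/-- The values `t - G` over all updates (of any of the `m` sensors) that are served at slot `t`,
where `G` is the generation time of the update. -/
def servedAges {m : ℕ} (s : Fin m → ℕ → ℕ) (t : ℕ) : Set ℕ :=
  {a | ∃ k i, servedTime (s k) i = t ∧ a = t - genTime (s k) i}

/-- Age of information at the monitor of `m` parallel zero-wait sensors, with age `δ₀` at time `0`:
`Δ[t+1]` is the minimum of `Δ[t] + 1` and of `t - G + 1` over all updates served at `t`. -/
def age {m : ℕ} (s : Fin m → ℕ → ℕ) (δ₀ : ℕ) : ℕ → ℕ
  | 0 => δ₀
  | t + 1 => sInf (insert (age s δ₀ t + 1) {b | ∃ a ∈ servedAges s t, b = a + 1})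

/-- A valid (fresh) update, i.e. one with `t - G < Δ[t]`, is received at slot `t`.  Of two updates
received in the same slot only one counts as valid, so there is at most one per slot. -/
def ValidAt {m : ℕ} (s : Fin m → ℕ → ℕ) (δ₀ t : ℕ) : Prop :=
  ∃ a ∈ servedAges s t, a < age s δ₀ t

open Classical in
/-- Number of valid updates received in the slots `0, …, n - 1`. -/
def validCount {m : ℕ} (s : Fin m → ℕ → ℕ) (δ₀ n : ℕ) : ℕ :=
  ∑ t ∈ Finset.range n, if ValidAt s δ₀ t then 1 else 0

open Classical in
/-- Sum of the age peaks in the slots `0, …, n - 1`; a peak is the age `Δ[t]` at a slot `t` at which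
a valid update is received. -/
def peakSum {m : ℕ} (s : Fin m → ℕ → ℕ) (δ₀ n : ℕ) : ℕ :=
  ∑ t ∈ Finset.range n, if ValidAt s δ₀ t then age s δ₀ t else 0

variable {Ω : Type*} [MeasurableSpace Ω]

/-- Expected time average of the age over the slots `0, …, n - 1`. -/
def meanAoI {m : ℕ} (P : Measure Ω) (S : Ω → Fin m → ℕ → ℕ) (δ₀ n : ℕ) : ℝ :=
  (∑ t ∈ Finset.range n, ∫ ω, (age (S ω) δ₀ t : ℝ) ∂P) / n

/-- Expected sum of the age peaks divided by the expected number of valid updates, over the slots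
`0, …, n - 1`. -/
def meanPAoI {m : ℕ} (P : Measure Ω) (S : Ω → Fin m → ℕ → ℕ) (δ₀ n : ℕ) : ℝ :=
  (∫ ω, (peakSum (S ω) δ₀ n : ℝ) ∂P) / (∫ ω, (validCount (S ω) δ₀ n : ℝ) ∂P)

/-- The average AoI (long-run limit). -/
def avgAoI {m : ℕ} (P : Measure Ω) (S : Ω → Fin m → ℕ → ℕ) (δ₀ : ℕ) : ℝ :=
  limUnder atTop (meanAoI P S δ₀)

/-- The average peak AoI (long-run limit). -/
def avgPAoI {m : ℕ} (P : Measure Ω) (S : Ω → Fin m → ℕ → ℕ) (δ₀ : ℕ) : ℝ :=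
  limUnder atTop (meanPAoI P S δ₀)

/-- The average AoI and the average peak AoI are well defined: the expectations are those of
integrable random variables, and the long-run limits exist. -/
def AveragesExist {m : ℕ} (P : Measure Ω) (S : Ω → Fin m → ℕ → ℕ) (δ₀ : ℕ) : Prop :=
  (∀ t, Integrable (fun ω => (age (S ω) δ₀ t : ℝ)) P) ∧
  (∀ n, Integrable (fun ω => (peakSum (S ω) δ₀ n : ℝ)) P) ∧
  (∀ n, Integrable (fun ω => (validCount (S ω) δ₀ n : ℝ)) P) ∧
  Tendsto (meanAoI P S δ₀) atTop (𝓝 (avgAoI P S δ₀)) ∧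
  Tendsto (meanPAoI P S δ₀) atTop (𝓝 (avgPAoI P S δ₀))

/-- `X 0, X 1, …` are independent and geometrically distributed on `{1, 2, …}` with success
parameter `p`. -/
structure IsGeometricService (P : Measure Ω) (X : ℕ → Ω → ℕ) (p : ℝ) : Prop where
  measurable : ∀ i, Measurable (X i)
  indep : iIndepFun X P
  law : ∀ i k, 1 ≤ k → P {ω | X i ω = k} = ENNReal.ofReal (p * (1 - p) ^ (k - 1))

/-- The ZW/Geo/1 queue: one sensor, with the random service times `X`. -/
def zwGeo (X : ℕ → Ω → ℕ) : Ω → Fin 1 → ℕ → ℕ := fun ω => ![fun i => X i ω]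

/-- The ZW/D/1 queue: one sensor, with constant service time `T`. -/
def zwD (Ω : Type*) (T : ℕ) : Ω → Fin 1 → ℕ → ℕ := fun _ => ![fun _ => T]

/-- The Geo-D system: both sensors in parallel. -/
def geoD (X : ℕ → Ω → ℕ) (T : ℕ) : Ω → Fin 2 → ℕ → ℕ := fun ω => ![fun i => X i ω, fun _ => T]

/-- Reduction ratio of the value `b` relative to the value `a`. -/
def reductionRatio (a b : ℝ) : ℝ := (a - b) / a

end

/-!
The receptions from the geometric sensor form a Bernoulli process: whatever the receptions before
a slot `t ≥ 1` are, slot `t` brings one with probability `p`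
(`IsGeometricService.setIntegral_comp_receptions`). Indeed, to prescribe the receptions before `t`
is to prescribe the first few service times and to require that the next one is long enough
(`receptions_eq_iff`), and the geometric law has no memory. All expectations below follow from
this fact by conditioning on one slot at a time.

Pathwise, the age of the geometric sensor in slot `t > a` exceeds `a` exactly when at most one of
the last `a` slots is a reception slot, since a fresher update has both its generation and its
reception in this window. The probability of this event is `q ^ a + a * p * q ^ (a - 1)` with `q =
1 - p` (`atMostOneProb`). The age of the deterministic sensor is the periodic function `dAge`, and
the age of the Geo-D system is the minimum of the two (`age_pair`), so from slot `T + 1` on the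
expected age is a partial sum `meanTruncAge` of these probabilities, periodic in `t`. A valid
reception in slot `t` is described by the receptions before `t` and the event of a reception in
`t` (`validAt_pair_of_dvd`, `validAt_pair_of_not_dvd`), so its probability and the expected peak
are explicit and periodic too.

The long-run averages are therefore averages over one period (`IsGeometricService.averages_geoD`),
while both averages of ZW/Geo/1 are `2 / p` and those of ZW/D/1 are `(3 * T + 1) / 2` and `2 * T`.
Summing the geometric series for `p = 1 / T` expresses everything through `1 / T`, `(1 - 1 / T) ^
T` and `(1 - 1 / T) ^ (T - 1)`, which tend to `0`, `e⁻¹` and `e⁻¹`.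
-/

/-! ### The age process of a single realization -/

section Pathwise

lemma genTime_zero (s : ℕ → ℕ) : genTime s 0 = 0 := by simp [genTime]

lemma genTime_succ (s : ℕ → ℕ) (i : ℕ) : genTime s (i + 1) = genTime s i + s i := by
  simp [genTime, Finset.sum_range_succ]

lemma servedTime_eq (s : ℕ → ℕ) (i : ℕ) : servedTime s i = genTime s (i + 1) := by
  rw [genTime_succ, servedTime]

lemma genTime_const (T i : ℕ) : genTime (fun _ => T) i = i * T := by simp [genTime]

lemma genTime_strictMono {s : ℕ → ℕ} (hs : ∀ i, 0 < s i) : StrictMono (genTime s) :=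
  strictMono_nat_of_lt_succ fun i => by rw [genTime_succ]; have := hs i; omega

lemma age_succ_le_iff {m : ℕ} (s : Fin m → ℕ → ℕ) (δ₀ t a : ℕ) :
    age s δ₀ (t + 1) ≤ a ↔ age s δ₀ t + 1 ≤ a ∨ ∃ x ∈ servedAges s t, x + 1 ≤ a := by
  rw [age]
  set U : Set ℕ := insert (age s δ₀ t + 1) {b | ∃ a ∈ servedAges s t, b = a + 1} with hU
  constructor
  · intro h
    have hmem : sInf U ∈ U := Nat.sInf_mem (Set.insert_nonempty _ _)
    rcases hmem with h1 | ⟨x, hx, h1⟩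
    · left; omega
    · right; exact ⟨x, hx, by omega⟩
  · rintro (h | ⟨x, hx, h⟩)
    · exact (Nat.sInf_le (Or.inl rfl)).trans h
    · exact (Nat.sInf_le (Or.inr ⟨x, hx, rfl⟩)).trans h

/-- The age is the time elapsed since the generation of the freshest update received in an earlier
slot; the initial age acts as an update generated `δ₀` slots before time `0`. -/
lemma age_le_iff {m : ℕ} (s : Fin m → ℕ → ℕ) (δ₀ t a : ℕ) :
    age s δ₀ t ≤ a ↔
      δ₀ + t ≤ a ∨ ∃ k i, servedTime (s k) i < t ∧ t ≤ a + genTime (s k) i := by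
  induction t generalizing a with
  | zero => simp [age]
  | succ t ih =>
    rw [age_succ_le_iff]
    cases a with
    | zero =>
      simp only [servedTime]
      constructor
      · rintro (h | ⟨x, -, h⟩) <;> omega
      · rintro (h | ⟨k, i, h1, h2⟩) <;> omega
    | succ a =>
      rw [Nat.add_le_add_iff_right, ih]
      constructor
      · rintro ((h | ⟨k, i, h1, h2⟩) | ⟨x, ⟨k, i, h1, h2⟩, h3⟩)
        · left; omega
        · right; exact ⟨k, i, by omega, by omega⟩
        · right; exact ⟨k, i, by omega, by omega⟩
      · rintro (h | ⟨k, i, h1, h2⟩)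
        · left; left; omega
        · rcases Nat.lt_succ_iff_lt_or_eq.mp h1 with h | h
          · left; right; exact ⟨k, i, h, by omega⟩
          · right; exact ⟨_, ⟨k, i, h, rfl⟩, by omega⟩

lemma age_le_add {m : ℕ} (s : Fin m → ℕ → ℕ) (δ₀ t : ℕ) : age s δ₀ t ≤ δ₀ + t :=
  (age_le_iff s δ₀ t _).2 (Or.inl le_rfl)

lemma validAt_iff {m : ℕ} (s : Fin m → ℕ → ℕ) (δ₀ t : ℕ) :
    ValidAt s δ₀ t ↔
      ∃ k i, servedTime (s k) i = t ∧ t - genTime (s k) i < age s δ₀ t := by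
  constructor
  · rintro ⟨a, ⟨k, i, h1, rfl⟩, h2⟩
    exact ⟨k, i, h1, h2⟩
  · rintro ⟨k, i, h1, h2⟩
    exact ⟨_, ⟨k, i, h1, rfl⟩, h2⟩

/-- Slot `t` is a reception slot of the sensor with service times `s`. -/
def IsReception (s : ℕ → ℕ) (t : ℕ) : Prop := ∃ i, servedTime s i = t

open Classical in
/-- The reception slots before `t` of the sensor with service times `s`. -/
noncomputable def receptions (s : ℕ → ℕ) (t : ℕ) : Finset ℕ :=
  (Finset.range t).filter (IsReception s)

/-- Number of elements of `A` among the last `a` slots `t - a, …, t - 1` before `t`, for a set `A`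
of slots before `t`. -/
def recent (A : Finset ℕ) (t a : ℕ) : ℕ := (A.filter fun x => t ≤ x + a).card

lemma mem_receptions {s : ℕ → ℕ} {t x : ℕ} :
    x ∈ receptions s t ↔ x < t ∧ ∃ i, genTime s (i + 1) = x := by
  simp [receptions, IsReception, servedTime_eq]

lemma isReception_iff {s : ℕ → ℕ} {t : ℕ} : IsReception s t ↔ ∃ i, genTime s (i + 1) = t := by
  simp [IsReception, servedTime_eq]

lemma not_isReception_zero {s : ℕ → ℕ} (hs : ∀ i, 0 < s i) : ¬ IsReception s 0 := by
  rw [isReception_iff]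
  rintro ⟨i, hi⟩
  rw [genTime_succ] at hi
  have := hs i
  omega

lemma recent_mono (A : Finset ℕ) (t : ℕ) {a b : ℕ} (h : a ≤ b) : recent A t a ≤ recent A t b :=
  Finset.card_le_card fun x hx => by
    rw [Finset.mem_filter] at hx ⊢
    exact ⟨hx.1, by omega⟩

lemma recent_zero (s : ℕ → ℕ) (t : ℕ) : recent (receptions s t) t 0 = 0 := by
  rw [recent, Finset.card_eq_zero, Finset.filter_eq_empty_iff]
  intro x hx
  have := (mem_receptions.1 hx).1
  omega

open Classical in
lemma recent_succ (s : ℕ → ℕ) (t a : ℕ) :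
    recent (receptions s (t + 1)) (t + 1) (a + 1) =
      recent (receptions s t) t a + if IsReception s t then 1 else 0 := by
  rw [receptions, Finset.range_add_one, Finset.filter_insert]
  have key : ∀ A : Finset ℕ, recent A (t + 1) (a + 1) = recent A t a := fun A => by
    unfold recent
    refine congrArg _ (Finset.filter_congr fun x _ => ?_)
    omega
  rw [key]
  split_ifs with h
  · rw [recent, Finset.filter_insert, if_pos (by omega), Finset.card_insert_of_notMem (by simp)]
    rfl
  · rfl

/-- An update generated within the last `a` slots has been received exactly when two of the
slots in this window are reception slots: its generation slot and its own reception slot. -/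
lemma exists_served_iff_two_le_recent {s : ℕ → ℕ} (hs : ∀ i, 0 < s i) {a t : ℕ} (h : a < t) :
    (∃ i, servedTime s i < t ∧ t ≤ a + genTime s i) ↔ 2 ≤ recent (receptions s t) t a := by
  have hm := genTime_strictMono hs
  rw [recent, ← Nat.lt_iff_add_one_le, Finset.one_lt_card]
  simp only [Finset.mem_filter, mem_receptions, servedTime_eq]
  constructor
  · rintro ⟨i, h1, h2⟩
    obtain ⟨j, rfl⟩ : ∃ j, i = j + 1 :=
      Nat.exists_eq_succ_of_ne_zero (by rintro rfl; rw [genTime_zero] at h2; omega)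
    have h3 : genTime s (j + 1) < genTime s (j + 1 + 1) := hm (Nat.lt_succ_self (j + 1))
    exact ⟨_, ⟨⟨h3.trans h1, j, rfl⟩, by omega⟩, _, ⟨⟨h1, _, rfl⟩, by omega⟩, h3.ne⟩
  · rintro ⟨x, ⟨⟨hx, i, rfl⟩, hxa⟩, y, ⟨⟨hy, j, rfl⟩, hya⟩, hne⟩
    have hij : i ≠ j := fun e => hne (by rw [e])
    rcases lt_or_gt_of_ne hij with hlt | hlt
    · exact ⟨j, hy, hxa.trans (by have := hm.monotone (Nat.add_one_le_of_lt hlt); omega)⟩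
    · exact ⟨i, hx, hya.trans (by have := hm.monotone (Nat.add_one_le_of_lt hlt); omega)⟩

lemma exists_served_iff_nonempty {s : ℕ → ℕ} {a t : ℕ} (h : t ≤ a) :
    (∃ i, servedTime s i < t ∧ t ≤ a + genTime s i) ↔ (receptions s t).Nonempty := by
  simp only [Finset.Nonempty, mem_receptions, servedTime_eq]
  constructor
  · rintro ⟨i, h1, -⟩
    exact ⟨_, h1, i, rfl⟩
  · rintro ⟨_, h1, i, rfl⟩
    exact ⟨i, h1, by omega⟩

/-- At a reception slot, the received update was generated in the previous reception slot, so it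
is younger than any number of slots within which there has been a reception. -/
lemma exists_served_eq_iff {s : ℕ → ℕ} (hs : ∀ i, 0 < s i) {a t : ℕ} (h : a < t) :
    (∃ i, servedTime s i = t ∧ t - genTime s i ≤ a) ↔
      IsReception s t ∧ 1 ≤ recent (receptions s t) t a := by
  have hm := genTime_strictMono hs
  rw [recent, Nat.one_le_iff_ne_zero, ← Nat.pos_iff_ne_zero, Finset.card_pos, isReception_iff]
  simp only [Finset.Nonempty, Finset.mem_filter, mem_receptions, servedTime_eq]
  constructor
  · rintro ⟨i, rfl, h2⟩
    obtain ⟨j, rfl⟩ : ∃ j, i = j + 1 :=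
      Nat.exists_eq_succ_of_ne_zero (by rintro rfl; rw [genTime_zero] at h2; omega)
    exact ⟨⟨_, rfl⟩, _, ⟨hm (Nat.lt_succ_self _), j, rfl⟩, by omega⟩
  · rintro ⟨⟨i, rfl⟩, _, ⟨h1, j, rfl⟩, h2⟩
    have hji : j + 1 ≤ i := by
      have := hm.lt_iff_lt.1 h1
      omega
    have := hm.monotone hji
    exact ⟨i, rfl, by omega⟩

/-- An update is not older than the last one received from the same sensor. -/
lemma recent_le_one_of_served {s : ℕ → ℕ} (hs : ∀ i, 0 < s i) {i t : ℕ} (h : servedTime s i = t) :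
    recent (receptions s t) t (t - genTime s i) ≤ 1 := by
  have hm := genTime_strictMono hs
  rw [recent, Finset.card_le_one]
  rw [servedTime_eq] at h
  have hit : genTime s i ≤ t := h ▸ hm.monotone (Nat.le_succ i)
  have key : ∀ x ∈ (receptions s t).filter (fun x => t ≤ x + (t - genTime s i)),
      x = genTime s i := by
    intro x hx
    rw [Finset.mem_filter, mem_receptions] at hx
    obtain ⟨⟨hxt, j, rfl⟩, hx⟩ := hx
    rw [← h] at hxt
    have h1 := hm.lt_iff_lt.1 hxt
    have h2 : i ≤ j + 1 := hm.le_iff_le.1 (by omega)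
    have : j + 1 = i := by omega
    rw [this]
  intro x hx y hy
  rw [key x hx, key y hy]

/-- The age `t - G`, truncated at `N`, of the freshest update received before `t` from a sensor
whose reception slots before `t` are the elements of `A`. -/
def truncAge (A : Finset ℕ) (t N : ℕ) : ℕ :=
  ∑ a ∈ Finset.range N, if recent A t a ≤ 1 then 1 else 0

lemma eq_sum_range_ite {n M : ℕ} (h : n ≤ M) :
    n = ∑ a ∈ Finset.range M, if a < n then 1 else 0 := by
  rw [Finset.sum_ite, Finset.sum_const_zero, add_zero, Finset.sum_const, smul_eq_mul, mul_one]
  have : (Finset.range M).filter (fun a => a < n) = Finset.range n := by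
    ext a; simp only [Finset.mem_filter, Finset.mem_range]; omega
  rw [this, Finset.card_range]

lemma truncAge_eq_self {A : Finset ℕ} {t N : ℕ} (h : recent A t (N - 1) ≤ 1) :
    truncAge A t N = N := by
  rw [truncAge, Finset.sum_congr rfl (g := fun _ => 1), Finset.sum_const, Finset.card_range,
    smul_eq_mul, mul_one]
  intro a ha
  rw [Finset.mem_range] at ha
  exact if_pos ((recent_mono A t (by omega)).trans h)

/-- Truncation has no effect beyond a level `N` at which the age does not exceed `N`. -/
lemma truncAge_eq_of_two_le_recent {A : Finset ℕ} {t N M : ℕ} (hNM : N ≤ M)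
    (h : 2 ≤ recent A t N) : truncAge A t M = truncAge A t N := by
  obtain ⟨k, rfl⟩ := Nat.exists_eq_add_of_le hNM
  rw [truncAge, Finset.sum_range_add, truncAge, Nat.add_eq_left]
  refine Finset.sum_eq_zero fun a _ => if_neg ?_
  have := recent_mono A t (Nat.le_add_right N a)
  omega

lemma lt_age_single_iff {s : ℕ → ℕ} (hs : ∀ i, 0 < s i) (δ₀ : ℕ) {a t : ℕ} (h : a < t) :
    a < age ![s] δ₀ t ↔ recent (receptions s t) t a ≤ 1 := by
  rw [← not_le, age_le_iff]
  simp only [Fin.exists_fin_one, Matrix.cons_val_fin_one, exists_served_iff_two_le_recent hs h]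
  omega

open Classical in
/-- The term `δ₀` enters as long as nothing has been received: the truncated age is then `t`, and
the age is `t + δ₀`. -/
lemma age_single {s : ℕ → ℕ} (hs : ∀ i, 0 < s i) (δ₀ t : ℕ) :
    age ![s] δ₀ t =
      truncAge (receptions s t) t t + if receptions s t = ∅ then δ₀ else 0 := by
  rw [eq_sum_range_ite (age_le_add ![s] δ₀ t), add_comm δ₀ t, Finset.sum_range_add]
  congr 1
  · refine Finset.sum_congr rfl fun a ha => ?_
    simp only [lt_age_single_iff hs δ₀ (Finset.mem_range.1 ha)]
  · rw [Finset.sum_congr rfl (g := fun _ => if receptions s t = ∅ then 1 else 0)]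
    · split_ifs <;> simp
    · intro a ha
      have ha := Finset.mem_range.1 ha
      have : t + a < age ![s] δ₀ t ↔ receptions s t = ∅ := by
        rw [← not_le, age_le_iff]
        simp only [Fin.exists_fin_one, Matrix.cons_val_fin_one,
          exists_served_iff_nonempty (Nat.le_add_right t a), ← Finset.not_nonempty_iff_eq_empty]
        have : ¬ δ₀ + t ≤ t + a := by omega
        tauto
      simp only [this]

/-- Every update of a single sensor is valid, with the possible exception of the first one. -/
lemma validAt_single {s : ℕ → ℕ} (hs : ∀ i, 0 < s i) (δ₀ t : ℕ) :
    ValidAt ![s] δ₀ t ↔ IsReception s t ∧ (receptions s t = ∅ → δ₀ ≠ 0) := by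
  have hm := genTime_strictMono hs
  rw [validAt_iff]
  simp only [Fin.exists_fin_one, Matrix.cons_val_fin_one, IsReception]
  rw [← exists_and_right]
  refine exists_congr fun i => and_congr_right fun hi => ?_
  by_cases h0 : i = 0
  · subst h0
    have he : receptions s t = ∅ := by
      rw [← Finset.not_nonempty_iff_eq_empty]
      rintro ⟨x, hx⟩
      obtain ⟨hxt, j, rfl⟩ := mem_receptions.1 hx
      rw [← hi, servedTime_eq, hm.lt_iff_lt] at hxt
      omega
    have h1 : recent (receptions s t) t (t - 1) ≤ 1 := by rw [he]; simp [recent]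
    rw [age_single hs, truncAge_eq_self h1, genTime_zero, if_pos he]
    simp [he]
    omega
  · have h1 : 0 < genTime s i := by
      rw [← genTime_zero s]; exact hm (Nat.pos_of_ne_zero h0)
    have h2 : genTime s i < t := by
      rw [← hi, servedTime_eq]; exact hm (Nat.lt_succ_self i)
    rw [lt_age_single_iff hs δ₀ (by omega)]
    refine iff_of_true (recent_le_one_of_served hs hi) fun he => ?_
    have : genTime s i ∈ receptions s t := by
      rw [mem_receptions]
      exact ⟨h2, i - 1, by rw [Nat.sub_add_cancel (Nat.pos_of_ne_zero h0)]⟩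
    rw [he] at this
    simp at this

/-- Age of the freshest update received before slot `t > T` from a sensor with constant service
time `T`. -/
def dAge (T t : ℕ) : ℕ := T + (t - 1) % T + 1

/-- The freshest update received before `t` is the one generated at `(d - 1) * T`, where `d` is the
number of multiples of `T` in `1, …, t - 1`. -/
lemma exists_served_const_iff {T t a : ℕ} (hT : 0 < T) (ht : T < t) :
    (∃ i, servedTime (fun _ => T) i < t ∧ t ≤ a + genTime (fun _ => T) i) ↔ dAge T t ≤ a := by
  simp only [servedTime_eq, genTime_const, dAge]
  have hdiv := Nat.div_add_mod (t - 1) T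
  have h1 : 1 ≤ (t - 1) / T := (Nat.one_le_div_iff hT).2 (by omega)
  obtain ⟨d, hd⟩ : ∃ d, (t - 1) / T = d + 1 := ⟨(t - 1) / T - 1, by omega⟩
  have hdT : T * (d + 1) = d * T + T := by ring
  rw [hd, hdT] at hdiv
  constructor
  · rintro ⟨i, hi1, hi2⟩
    have : i + 1 ≤ d + 1 := by
      rw [← hd, Nat.le_div_iff_mul_le hT]; omega
    have : i * T ≤ d * T := Nat.mul_le_mul_right T (by omega)
    omega
  · intro h
    exact ⟨d, by rw [add_mul]; omega, by omega⟩

lemma dAge_le {T t : ℕ} (hT : 0 < T) (ht : T < t) : dAge T t ≤ t := by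
  have hdiv := Nat.div_add_mod (t - 1) T
  have h1 : 1 ≤ (t - 1) / T := (Nat.one_le_div_iff hT).2 (by omega)
  have := Nat.mul_le_mul_left T h1
  unfold dAge
  omega

lemma dAge_of_dvd {T t : ℕ} (hT : 0 < T) (ht : T < t) (h : T ∣ t) : dAge T t = 2 * T := by
  obtain ⟨k, rfl⟩ := h
  obtain ⟨j, rfl⟩ : ∃ j, k = j + 1 :=
    Nat.exists_eq_succ_of_ne_zero (by rintro rfl; omega)
  have : T * (j + 1) - 1 = (T - 1) + T * j := by rw [mul_add]; omega
  rw [dAge, this, Nat.add_mul_mod_self_left, Nat.mod_eq_of_lt (by omega)]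
  omega

lemma exists_served_const_eq_iff {T t : ℕ} (ht : T < t) (q : ℕ → Prop) :
    (∃ i, servedTime (fun _ => T) i = t ∧ q (t - genTime (fun _ => T) i)) ↔ T ∣ t ∧ q T := by
  simp only [servedTime_eq, genTime_const]
  constructor
  · rintro ⟨i, rfl, h⟩
    refine ⟨Dvd.intro_left _ rfl, ?_⟩
    convert h using 1
    rw [add_mul]; omega
  · rintro ⟨⟨k, rfl⟩, h⟩
    obtain ⟨j, rfl⟩ : ∃ j, k = j + 1 :=
      Nat.exists_eq_succ_of_ne_zero (by rintro rfl; omega)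
    refine ⟨j, by ring, ?_⟩
    convert h using 1
    rw [mul_add, mul_comm T j]; omega

lemma age_const {T t : ℕ} (hT : 0 < T) (ht : T < t) (δ₀ : ℕ) :
    age ![fun _ => T] δ₀ t = dAge T t := by
  have hle := dAge_le hT ht
  refine eq_of_forall_ge_iff fun a => ?_
  rw [age_le_iff]
  simp only [Fin.exists_fin_one, Matrix.cons_val_fin_one, exists_served_const_iff hT ht]
  omega

lemma validAt_const {T t : ℕ} (hT : 0 < T) (ht : T < t) (δ₀ : ℕ) :
    ValidAt ![fun _ => T] δ₀ t ↔ T ∣ t := by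
  rw [validAt_iff, age_const hT ht]
  simp only [Fin.exists_fin_one, Matrix.cons_val_fin_one]
  rw [exists_served_const_eq_iff ht (fun a => a < dAge T t)]
  simp only [and_iff_left_iff_imp, dAge]
  omega

lemma lt_age_pair_iff {s : ℕ → ℕ} (hs : ∀ i, 0 < s i) {T t a : ℕ} (hT : 0 < T) (ht : T < t)
    (δ₀ : ℕ) :
    a < age ![s, fun _ => T] δ₀ t ↔ a < dAge T t ∧ recent (receptions s t) t a ≤ 1 := by
  have hle := dAge_le hT ht
  rw [← not_le, age_le_iff]
  simp only [Fin.exists_fin_two, Matrix.cons_val_zero, Matrix.cons_val_one,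
    exists_served_const_iff hT ht]
  by_cases h : a < t
  · rw [exists_served_iff_two_le_recent hs h]
    omega
  · have h1 : dAge T t ≤ a := by omega
    simp [h1]

/-- The age of a sensor in parallel with one of constant service time is the smaller of the two. -/
lemma age_pair {s : ℕ → ℕ} (hs : ∀ i, 0 < s i) {T t : ℕ} (hT : 0 < T) (ht : T < t) (δ₀ : ℕ) :
    age ![s, fun _ => T] δ₀ t = truncAge (receptions s t) t (dAge T t) := by
  have hle : age ![s, fun _ => T] δ₀ t ≤ dAge T t := by
    rw [← not_lt, lt_age_pair_iff hs hT ht]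
    omega
  rw [eq_sum_range_ite hle, truncAge]
  refine Finset.sum_congr rfl fun a ha => ?_
  rw [Finset.mem_range] at ha
  simp only [lt_age_pair_iff hs hT ht, ha, true_and]

lemma validAt_pair_iff {s : ℕ → ℕ} (hs : ∀ i, 0 < s i) {T t : ℕ} (hT : 0 < T) (ht : T < t)
    (δ₀ : ℕ) :
    ValidAt ![s, fun _ => T] δ₀ t ↔
      (IsReception s t ∧ 1 ≤ recent (receptions s t) t (dAge T t - 1)) ∨
        (T ∣ t ∧ recent (receptions s t) t T ≤ 1) := by
  have hle := dAge_le hT ht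
  have hpos : T < dAge T t := by unfold dAge; omega
  rw [validAt_iff]
  simp only [Fin.exists_fin_two, Matrix.cons_val_zero, Matrix.cons_val_one]
  rw [exists_served_const_eq_iff ht (fun a => a < age ![s, fun _ => T] δ₀ t),
    ← exists_served_eq_iff hs (a := dAge T t - 1) (by omega)]
  simp only [lt_age_pair_iff hs hT ht]
  refine or_congr (exists_congr fun i => and_congr_right fun hi => ?_) ?_
  · have := recent_le_one_of_served hs hi
    omega
  · simp [hpos]

/-- When only the first sensor may deliver in slot `t`, its update is valid if it is younger than
the one last received from the sensor with constant service time. -/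
lemma validAt_pair_of_not_dvd {s : ℕ → ℕ} (hs : ∀ i, 0 < s i) {T t : ℕ} (hT : 0 < T) (ht : T < t)
    (hd : ¬ T ∣ t) (δ₀ : ℕ) :
    ValidAt ![s, fun _ => T] δ₀ t ↔
      IsReception s t ∧ recent (receptions s t) t (dAge T t - 1) ≠ 0 := by
  rw [validAt_pair_iff hs hT ht, Nat.one_le_iff_ne_zero]
  simp [hd]

/-- When both sensors may deliver in slot `t`, the update of constant age `T` is valid unless the
monitor already has one of age at most `T`; in that case the first sensor has had a reception within
the last `T` slots, so a reception from it is valid. -/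
lemma validAt_pair_of_dvd {s : ℕ → ℕ} (hs : ∀ i, 0 < s i) {T t : ℕ} (hT : 0 < T) (ht : T < t)
    (hd : T ∣ t) (δ₀ : ℕ) :
    ValidAt ![s, fun _ => T] δ₀ t ↔ (recent (receptions s t) t T ≤ 1 ∨ IsReception s t) := by
  rw [validAt_pair_iff hs hT ht]
  have h := recent_mono (receptions s t) t (a := T) (b := dAge T t - 1) (by unfold dAge; omega)
  by_cases h1 : recent (receptions s t) t T ≤ 1
  · simp [h1, hd]
  · have : 1 ≤ recent (receptions s t) t (dAge T t - 1) := by omega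
    simp [h1, this]

end Pathwise

/-! ### Measurability and integrability -/

section Measurability

variable {Ω : Type*} [MeasurableSpace Ω]

lemma measurable_genTime {Y : Ω → ℕ → ℕ} (hY : ∀ i, Measurable fun ω => Y ω i) (i : ℕ) :
    Measurable fun ω => genTime (Y ω) i :=
  Finset.measurable_fun_sum _ fun j _ => hY j

lemma measurable_servedTime {Y : Ω → ℕ → ℕ} (hY : ∀ i, Measurable fun ω => Y ω i) (i : ℕ) :
    Measurable fun ω => servedTime (Y ω) i :=
  (measurable_genTime hY i).add (hY i)

lemma measurable_age {m : ℕ} {S : Ω → Fin m → ℕ → ℕ} (hS : ∀ k i, Measurable fun ω => S ω k i)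
    (δ₀ t : ℕ) : Measurable fun ω => age (S ω) δ₀ t := by
  refine measurable_of_Iic fun a => ?_
  have : (fun ω => age (S ω) δ₀ t) ⁻¹' Set.Iic a = {ω | δ₀ + t ≤ a} ∪
      ⋃ k, ⋃ i, ({ω | servedTime (S ω k) i < t} ∩ {ω | t ≤ a + genTime (S ω k) i}) := by
    ext ω
    simp [age_le_iff]
  rw [this]
  refine (MeasurableSet.const _).union
    (MeasurableSet.iUnion fun k => MeasurableSet.iUnion fun i => ?_)
  exact (measurableSet_lt (measurable_servedTime (hS k) i) measurable_const).inter
    (measurableSet_le measurable_const (measurable_const.add (measurable_genTime (hS k) i)))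

lemma measurableSet_validAt {m : ℕ} {S : Ω → Fin m → ℕ → ℕ}
    (hS : ∀ k i, Measurable fun ω => S ω k i) (δ₀ t : ℕ) :
    MeasurableSet {ω | ValidAt (S ω) δ₀ t} := by
  have : {ω | ValidAt (S ω) δ₀ t} = ⋃ k, ⋃ i, ({ω | servedTime (S ω k) i = t} ∩
      {ω | t - genTime (S ω k) i < age (S ω) δ₀ t}) := by
    ext ω
    simp [validAt_iff]
  rw [this]
  refine MeasurableSet.iUnion fun k => MeasurableSet.iUnion fun i => ?_
  exact (measurableSet_eq_fun (measurable_servedTime (hS k) i) measurable_const).inter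
    (measurableSet_lt (measurable_const.sub (measurable_genTime (hS k) i))
      (measurable_age hS δ₀ t))

lemma measurableSet_isReception {Y : Ω → ℕ → ℕ} (hY : ∀ i, Measurable fun ω => Y ω i) (t : ℕ) :
    MeasurableSet {ω | IsReception (Y ω) t} := by
  simp only [IsReception, Set.ofPred_exists]
  exact MeasurableSet.iUnion fun i =>
    measurableSet_eq_fun (measurable_servedTime hY i) measurable_const

lemma measurableSet_receptions_eq {Y : Ω → ℕ → ℕ} (hY : ∀ i, Measurable fun ω => Y ω i) (t : ℕ)
    (A : Finset ℕ) : MeasurableSet {ω | receptions (Y ω) t = A} := by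
  have : {ω | receptions (Y ω) t = A} =
      ⋂ x, {ω | (x < t ∧ IsReception (Y ω) x) ↔ x ∈ A} := by
    ext ω
    simp [Finset.ext_iff, receptions]
  rw [this]
  refine MeasurableSet.iInter fun x => ?_
  exact ((MeasurableSet.const _).inter (measurableSet_isReception hY x)).iff (MeasurableSet.const _)

variable {P : Measure Ω}

lemma integrable_age [IsFiniteMeasure P] {m : ℕ} {S : Ω → Fin m → ℕ → ℕ}
    (hS : ∀ k i, Measurable fun ω => S ω k i) (δ₀ t : ℕ) :
    Integrable (fun ω => (age (S ω) δ₀ t : ℝ)) P := by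
  refine Integrable.of_bound (C := ((δ₀ + t : ℕ) : ℝ))
    ((measurable_of_countable _).comp (measurable_age hS δ₀ t)).aestronglyMeasurable
    (Eventually.of_forall fun ω => ?_)
  rw [Real.norm_natCast, Nat.cast_le]
  exact age_le_add _ _ _

open Classical in
lemma integrable_valid [IsFiniteMeasure P] {m : ℕ} {S : Ω → Fin m → ℕ → ℕ}
    (hS : ∀ k i, Measurable fun ω => S ω k i) (δ₀ t : ℕ) :
    Integrable (fun ω => if ValidAt (S ω) δ₀ t then (1 : ℝ) else 0) P :=
  (integrable_const (1 : ℝ)).indicator (measurableSet_validAt hS δ₀ t)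

open Classical in
lemma integrable_peak [IsFiniteMeasure P] {m : ℕ} {S : Ω → Fin m → ℕ → ℕ}
    (hS : ∀ k i, Measurable fun ω => S ω k i) (δ₀ t : ℕ) :
    Integrable (fun ω => if ValidAt (S ω) δ₀ t then (age (S ω) δ₀ t : ℝ) else 0) P :=
  (integrable_age hS δ₀ t).indicator (measurableSet_validAt hS δ₀ t)

lemma receptions_subset (s : ℕ → ℕ) (t : ℕ) : receptions s t ⊆ Finset.range t := fun _ hx =>
  Finset.mem_range.2 (mem_receptions.1 hx).1

omit [MeasurableSpace Ω] in
lemma comp_receptions_eq_sum (Y : Ω → ℕ → ℕ) (t : ℕ) (f : Finset ℕ → ℝ) (ω : Ω) :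
    f (receptions (Y ω) t) = ∑ A ∈ (Finset.range t).powerset,
      {ω | receptions (Y ω) t = A}.indicator (fun _ => f A) ω := by
  classical
  simp only [Set.indicator_apply, Set.mem_ofPred_eq]
  rw [Finset.sum_ite_eq, if_pos (Finset.mem_powerset.2 (receptions_subset (Y ω) t))]

lemma integrable_comp_receptions [IsFiniteMeasure P] {Y : Ω → ℕ → ℕ}
    (hY : ∀ i, Measurable fun ω => Y ω i) (t : ℕ) (f : Finset ℕ → ℝ) :
    Integrable (fun ω => f (receptions (Y ω) t)) P := by
  simp only [comp_receptions_eq_sum Y t f]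
  exact integrable_finsetSum _ fun A _ =>
    (integrable_const (f A)).indicator (measurableSet_receptions_eq hY t A)

lemma integral_comp_receptions [IsFiniteMeasure P] {Y : Ω → ℕ → ℕ}
    (hY : ∀ i, Measurable fun ω => Y ω i) (t : ℕ) (f : Finset ℕ → ℝ) :
    ∫ ω, f (receptions (Y ω) t) ∂P =
      ∑ A ∈ (Finset.range t).powerset, P.real {ω | receptions (Y ω) t = A} * f A := by
  simp only [comp_receptions_eq_sum Y t f]
  rw [integral_finsetSum _ fun A _ =>
    (integrable_const (f A)).indicator (measurableSet_receptions_eq hY t A)]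
  refine Finset.sum_congr rfl fun A _ => ?_
  exact (integral_indicator_const (f A) (measurableSet_receptions_eq hY t A)).trans
    (smul_eq_mul _ _)

end Measurability

/-! ### Receptions of the geometric sensor -/

section Bernoulli

/-- The slot `t` lies between the consecutive receptions `k` and `k + 1`, so the receptions before
`t` are the first `k` ones. -/
lemma receptions_eq_image {s : ℕ → ℕ} (hs : ∀ i, 0 < s i) {k t : ℕ} (h1 : genTime s k < t)
    (h2 : t ≤ genTime s (k + 1)) :
    receptions s t = (Finset.range k).image fun i => genTime s (i + 1) := by
  have hm := genTime_strictMono hs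
  ext x
  simp only [mem_receptions, Finset.mem_image, Finset.mem_range]
  constructor
  · rintro ⟨hx, i, rfl⟩
    exact ⟨i, by have := hm.lt_iff_lt.1 (hx.trans_le h2); omega, rfl⟩
  · rintro ⟨i, hi, rfl⟩
    exact ⟨(hm.monotone (Nat.add_one_le_of_lt hi)).trans_lt h1, i, rfl⟩

lemma card_image_genTime {s : ℕ → ℕ} (hs : ∀ i, 0 < s i) (k : ℕ) :
    ((Finset.range k).image fun i => genTime s (i + 1)).card = k := by
  rw [Finset.card_image_of_injective, Finset.card_range]
  exact (genTime_strictMono hs).injective.comp (add_left_injective 1)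

lemma sup_image_genTime {s : ℕ → ℕ} (hs : ∀ i, 0 < s i) (k : ℕ) :
    ((Finset.range k).image fun i => genTime s (i + 1)).sup id = genTime s k := by
  have hm := genTime_strictMono hs
  refine le_antisymm ?_ ?_
  · simp only [Finset.sup_le_iff, Finset.mem_image, Finset.mem_range, forall_exists_index, and_imp]
    rintro _ i hi rfl
    exact hm.monotone (Nat.add_one_le_of_lt hi)
  · cases k with
    | zero => rw [genTime_zero]; exact Nat.zero_le _
    | succ k =>
      exact Finset.le_sup (f := id) (Finset.mem_image_of_mem _ (Finset.self_mem_range_succ k))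

lemma exists_genTime_lt_le {s : ℕ → ℕ} (hs : ∀ i, 0 < s i) {t : ℕ} (ht : 0 < t) :
    ∃ k, genTime s k < t ∧ t ≤ genTime s (k + 1) := by
  have hex : ∃ n, t ≤ genTime s n := ⟨t, (genTime_strictMono hs).le_apply⟩
  classical
  obtain ⟨k, hk⟩ : ∃ k, Nat.find hex = k + 1 := Nat.exists_eq_succ_of_ne_zero fun h => by
    have := Nat.find_spec hex
    rw [h, genTime_zero] at this
    omega
  refine ⟨k, ?_, hk ▸ Nat.find_spec hex⟩
  exact not_le.1 (Nat.find_min hex (by omega))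

/-- The receptions before `t` form the set `A` when the first `#A` receptions are those of `A` and
the next service time reaches up to `t` at least. -/
lemma receptions_eq_iff {s : ℕ → ℕ} (hs : ∀ i, 0 < s i) {t : ℕ} (ht : 0 < t) {A : Finset ℕ}
    (hA : A ⊆ Finset.range t) :
    receptions s t = A ↔ ((Finset.range A.card).image fun i => genTime s (i + 1)) = A ∧
      t ≤ A.sup id + s A.card := by
  constructor
  · rintro rfl
    obtain ⟨k, h1, h2⟩ := exists_genTime_lt_le hs ht
    rw [receptions_eq_image hs h1 h2, card_image_genTime hs, sup_image_genTime hs, ← genTime_succ]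
    exact ⟨rfl, h2⟩
  · rintro ⟨h1, h2⟩
    have h3 : genTime s A.card = A.sup id := by
      rw [← sup_image_genTime hs, h1]
    rw [← h3, ← genTime_succ] at h2
    rw [receptions_eq_image hs _ h2, h1]
    rw [h3, Finset.sup_lt_iff (by simpa using ht)]
    exact fun x hx => Finset.mem_range.1 (hA hx)

lemma receptions_eq_and_isReception_iff {s : ℕ → ℕ} (hs : ∀ i, 0 < s i) {t : ℕ} (ht : 0 < t)
    {A : Finset ℕ} (hA : A ⊆ Finset.range t) :
    receptions s t = A ∧ IsReception s t ↔
      ((Finset.range A.card).image fun i => genTime s (i + 1)) = A ∧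
        A.sup id + s A.card = t := by
  have hm := genTime_strictMono hs
  rw [receptions_eq_iff hs ht hA, and_assoc]
  refine and_congr_right fun h => ?_
  have h3 : genTime s A.card = A.sup id := by
    rw [← sup_image_genTime hs, h]
  rw [← h3, ← genTime_succ, isReception_iff]
  constructor
  · rintro ⟨h1, i, hi⟩
    refine le_antisymm ?_ h1
    rw [← hi, hm.le_iff_le]
    have : genTime s A.card < genTime s (i + 1) := by
      rw [hi, h3, Finset.sup_lt_iff (by simpa using ht)]
      exact fun x hx => Finset.mem_range.1 (hA hx)
    have := hm.lt_iff_lt.1 this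
    omega
  · intro h1
    exact ⟨h1.ge, _, h1⟩

variable {Ω : Type*} [MeasurableSpace Ω] {P : Measure Ω} [IsProbabilityMeasure P]
  {X : ℕ → Ω → ℕ} {p : ℝ}

omit [IsProbabilityMeasure P] in
lemma IsGeometricService.real_eq_succ (hX : IsGeometricService P X p) (hp0 : 0 < p) (hp1 : p < 1)
    (i n : ℕ) : P.real {ω | X i ω = n + 1} = p * (1 - p) ^ n := by
  have h := hX.law i (n + 1) (by omega)
  rw [Measure.real, h, ENNReal.toReal_ofReal, Nat.add_sub_cancel]
  exact mul_nonneg hp0.le (pow_nonneg (by linarith) _)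

/-- The masses prescribed on the positive integers add up to `1`, so there is none left at `0`. -/
lemma IsGeometricService.real_lt (hX : IsGeometricService P X p) (hp0 : 0 < p) (hp1 : p < 1)
    (i n : ℕ) : P.real {ω | n < X i ω} = (1 - p) ^ n := by
  have hstep : ∀ n, P.real {ω | n < X i ω} =
      P.real {ω | n + 1 < X i ω} + p * (1 - p) ^ n := fun n => by
    rw [← hX.real_eq_succ hp0 hp1 i n, ← measureReal_union]
    · congr 1
      ext ω
      simp only [Set.mem_ofPred_eq, Set.mem_union]
      omega
    · rw [Set.disjoint_left]
      intro ω h1 h2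
      simp only [Set.mem_ofPred_eq] at h1 h2
      omega
    · exact measurableSet_eq_fun (hX.measurable i) measurable_const
  -- The constant is `-P (X i = 0)`; it vanishes because the tail probabilities are nonnegative.
  have hconst : ∀ n, P.real {ω | n < X i ω} = P.real {ω | 0 < X i ω} - 1 + (1 - p) ^ n := by
    intro n
    induction n with
    | zero => simp
    | succ n ih =>
      have := hstep n
      rw [pow_succ]
      linarith
  have hlim : Tendsto (fun n : ℕ => P.real {ω | 0 < X i ω} - 1 + (1 - p) ^ n) atTop
      (𝓝 (P.real {ω | 0 < X i ω} - 1 + 0)) :=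
    (tendsto_pow_atTop_nhds_zero_of_lt_one (by linarith) (by linarith)).const_add _
  have h0 : 0 ≤ P.real {ω | 0 < X i ω} - 1 + 0 :=
    ge_of_tendsto' hlim fun n => hconst n ▸ measureReal_nonneg
  have h1 : P.real {ω | 0 < X i ω} ≤ 1 := measureReal_le_one
  rw [hconst n]
  linarith

lemma IsGeometricService.ae_pos (hX : IsGeometricService P X p) (hp0 : 0 < p) (hp1 : p < 1) :
    ∀ᵐ ω ∂P, ∀ i, 0 < X i ω := by
  rw [ae_all_iff]
  intro i
  have hms : MeasurableSet {ω | 0 < X i ω} := measurableSet_lt measurable_const (hX.measurable i)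
  have h : P.real {ω | 0 < X i ω}ᶜ = 0 := by
    rw [probReal_compl_eq_one_sub hms, hX.real_lt hp0 hp1]
    simp
  rw [ae_iff]
  exact (measureReal_eq_zero_iff).1 h

omit [IsProbabilityMeasure P] in
/-- The first `k` reception slots are independent of the next service time. -/
lemma IsGeometricService.real_image_inter (hX : IsGeometricService P X p) (k : ℕ) (A : Finset ℕ)
    (U : Set ℕ) :
    P.real ({ω | ((Finset.range k).image fun i => genTime (fun j => X j ω) (i + 1)) = A} ∩
        {ω | X k ω ∈ U}) =
      P.real {ω | ((Finset.range k).image fun i => genTime (fun j => X j ω) (i + 1)) = A} *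
        P.real {ω | X k ω ∈ U} := by
  have hind := hX.indep.indepFun_finset (Finset.range k) {k}
    (by simp) hX.measurable
  -- The first `k` receptions only depend on the first `k` service times; the others are set to `0`.
  let ext : (Finset.range k → ℕ) → ℕ → ℕ := fun y j =>
    if h : j ∈ Finset.range k then y ⟨j, h⟩ else 0
  have hD : {ω | ((Finset.range k).image fun i => genTime (fun j => X j ω) (i + 1)) = A} =
      (fun ω (i : Finset.range k) => X i ω) ⁻¹'
        {y | ((Finset.range k).image fun i => genTime (ext y) (i + 1)) = A} := by
    ext ω
    simp only [Set.mem_ofPred_eq, Set.mem_preimage]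
    rw [Finset.image_congr (g := fun i => genTime (ext fun j : Finset.range k => X j ω) (i + 1))]
    intro i hi
    refine Finset.sum_congr rfl fun j hj => ?_
    have : j ∈ Finset.range k := by
      simp only [Finset.coe_range, Set.mem_Iio, Finset.mem_range] at hi hj ⊢
      omega
    simp only [ext, dif_pos this]
  have hU : {ω | X k ω ∈ U} =
      (fun ω (i : ({k} : Finset ℕ)) => X i ω) ⁻¹'
        {y | y ⟨k, Finset.mem_singleton_self k⟩ ∈ U} := rfl
  rw [hD, hU, Measure.real, Measure.real, Measure.real,
    hind.measure_inter_preimage_eq_mul _ _ (Set.to_countable _).measurableSet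
      (Set.to_countable _).measurableSet, ENNReal.toReal_mul]

/-- Memorylessness: whatever the receptions before slot `t` are, there is a reception in slot `t`
with probability `p`. -/
lemma IsGeometricService.real_receptions_eq_inter (hX : IsGeometricService P X p) (hp0 : 0 < p)
    (hp1 : p < 1) {t : ℕ} (ht : 0 < t) {A : Finset ℕ} (hA : A ⊆ Finset.range t) :
    P.real ({ω | receptions (fun i => X i ω) t = A} ∩ {ω | IsReception (fun i => X i ω) t}) =
      p * P.real {ω | receptions (fun i => X i ω) t = A} := by
  have hsup : A.sup id < t := by
    rw [Finset.sup_lt_iff (by simpa using ht)]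
    exact fun x hx => Finset.mem_range.1 (hA hx)
  obtain ⟨n, hn⟩ : ∃ n, t = A.sup id + n + 1 := ⟨t - A.sup id - 1, by omega⟩
  set D := {ω | ((Finset.range A.card).image fun i => genTime (fun j => X j ω) (i + 1)) = A} with hD
  have h1 : P.real {ω | receptions (fun i => X i ω) t = A} =
      P.real (D ∩ {ω | X A.card ω ∈ Set.Ioi n}) := by
    refine measureReal_congr ?_
    filter_upwards [hX.ae_pos hp0 hp1] with ω hω
    refine propext ((receptions_eq_iff hω ht hA).trans (and_congr Iff.rfl ?_))
    change t ≤ A.sup id + X A.card ω ↔ n < X A.card ω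
    omega
  have h2 : P.real ({ω | receptions (fun i => X i ω) t = A} ∩
      {ω | IsReception (fun i => X i ω) t}) =
        P.real (D ∩ {ω | X A.card ω ∈ ({n + 1} : Set ℕ)}) := by
    refine measureReal_congr ?_
    filter_upwards [hX.ae_pos hp0 hp1] with ω hω
    refine propext ((receptions_eq_and_isReception_iff hω ht hA).trans (and_congr Iff.rfl ?_))
    change A.sup id + X A.card ω = t ↔ X A.card ω = n + 1
    omega
  rw [h1, h2, hX.real_image_inter, hX.real_image_inter]
  have h3 : P.real {ω | X A.card ω ∈ Set.Ioi n} = (1 - p) ^ n := hX.real_lt hp0 hp1 _ n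
  have h4 : P.real {ω | X A.card ω ∈ ({n + 1} : Set ℕ)} = p * (1 - p) ^ n :=
    hX.real_eq_succ hp0 hp1 _ n
  rw [h3, h4]
  ring

/-- A reception in slot `t` occurs with probability `p`, independently of the earlier ones. -/
lemma IsGeometricService.setIntegral_comp_receptions (hX : IsGeometricService P X p) (hp0 : 0 < p)
    (hp1 : p < 1) {t : ℕ} (ht : 0 < t) (f : Finset ℕ → ℝ) :
    ∫ ω in {ω | IsReception (fun i => X i ω) t}, f (receptions (fun i => X i ω) t) ∂P =
      p * ∫ ω, f (receptions (fun i => X i ω) t) ∂P := by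
  have hm : ∀ i, Measurable fun ω => (fun (ω : Ω) (i : ℕ) => X i ω) ω i := hX.measurable
  rw [integral_comp_receptions hm, integral_comp_receptions hm, Finset.mul_sum]
  refine Finset.sum_congr rfl fun A hA => ?_
  rw [measureReal_restrict_apply (measurableSet_receptions_eq hm t A),
    hX.real_receptions_eq_inter hp0 hp1 ht (Finset.mem_powerset.1 hA)]
  ring

open Classical in
/-- Conditioning on the event of a reception in slot `t`. -/
lemma IsGeometricService.integral_ite_isReception (hX : IsGeometricService P X p) (hp0 : 0 < p)
    (hp1 : p < 1) {t : ℕ} (ht : 0 < t) (f g : Finset ℕ → ℝ) :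
    ∫ ω, (if IsReception (fun i => X i ω) t then f (receptions (fun i => X i ω) t)
        else g (receptions (fun i => X i ω) t)) ∂P =
      p * ∫ ω, f (receptions (fun i => X i ω) t) ∂P +
        (1 - p) * ∫ ω, g (receptions (fun i => X i ω) t) ∂P := by
  have hm : ∀ i, Measurable fun ω => (fun (ω : Ω) (i : ℕ) => X i ω) ω i := hX.measurable
  have hB := measurableSet_isReception hm t
  have hf : Integrable (fun ω => f (receptions (fun i => X i ω) t)) P :=
    integrable_comp_receptions hm t f
  have hg : Integrable (fun ω => g (receptions (fun i => X i ω) t)) P :=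
    integrable_comp_receptions hm t g
  have h1 := integral_piecewise hB hf.integrableOn hg.integrableOn
  have h2 := integral_add_compl hB hg
  rw [hX.setIntegral_comp_receptions hp0 hp1 ht g] at h2
  rw [hX.setIntegral_comp_receptions hp0 hp1 ht f] at h1
  refine Eq.trans ?_ (h1.trans ?_)
  · rfl
  · linarith

/-- Probability of at most one reception in `a` consecutive slots. -/
noncomputable def atMostOneProb (p : ℝ) (a : ℕ) : ℝ := (1 - p) ^ a + a * p * (1 - p) ^ (a - 1)

lemma atMostOneProb_succ (p : ℝ) (a : ℕ) :
    atMostOneProb p (a + 1) = (1 - p) * atMostOneProb p a + p * (1 - p) ^ a := by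
  unfold atMostOneProb
  cases a with
  | zero => simp
  | succ a => simp only [Nat.add_sub_cancel]; push_cast; ring

lemma IsGeometricService.integral_recent_eq_zero (hX : IsGeometricService P X p) (hp0 : 0 < p)
    (hp1 : p < 1) {a t : ℕ} (h : a < t) :
    ∫ ω, (if recent (receptions (fun i => X i ω) t) t a = 0 then (1 : ℝ) else 0) ∂P =
      (1 - p) ^ a := by
  classical
  induction a generalizing t with
  | zero => simp [recent_zero]
  | succ a ih =>
    obtain ⟨t, rfl⟩ : ∃ u, t = u + 1 := ⟨t - 1, by omega⟩
    have hi := hX.integral_ite_isReception hp0 hp1 (t := t) (by omega) (fun _ => 0)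
      (fun A => if recent A t a = 0 then 1 else 0)
    rw [ih (by omega)] at hi
    rw [pow_succ', ← zero_add ((1 - p) * _), ← mul_zero p]
    refine Eq.trans (integral_congr_ae (Eventually.of_forall fun ω => ?_)) (hi.trans (by simp))
    by_cases hB : IsReception (fun i => X i ω) t <;> simp [recent_succ, hB]

lemma IsGeometricService.integral_recent_le_one (hX : IsGeometricService P X p) (hp0 : 0 < p)
    (hp1 : p < 1) {a t : ℕ} (h : a < t) :
    ∫ ω, (if recent (receptions (fun i => X i ω) t) t a ≤ 1 then (1 : ℝ) else 0) ∂P =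
      atMostOneProb p a := by
  classical
  induction a generalizing t with
  | zero => simp [recent_zero, atMostOneProb]
  | succ a ih =>
    obtain ⟨t, rfl⟩ : ∃ u, t = u + 1 := ⟨t - 1, by omega⟩
    have hi := hX.integral_ite_isReception hp0 hp1 (t := t) (by omega)
      (fun A => if recent A t a = 0 then 1 else 0) (fun A => if recent A t a ≤ 1 then 1 else 0)
    rw [ih (by omega), hX.integral_recent_eq_zero hp0 hp1 (by omega)] at hi
    rw [atMostOneProb_succ, add_comm (_ * _)]
    refine Eq.trans (integral_congr_ae (Eventually.of_forall fun ω => ?_)) hi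
    by_cases hB : IsReception (fun i => X i ω) t <;> simp [recent_succ, hB]

/-- Expectation of the age of the geometric sensor truncated at `N`, in every slot `t ≥ N`. -/
noncomputable def meanTruncAge (p : ℝ) (N : ℕ) : ℝ := ∑ a ∈ Finset.range N, atMostOneProb p a

lemma IsGeometricService.integral_truncAge (hX : IsGeometricService P X p) (hp0 : 0 < p)
    (hp1 : p < 1) {N t : ℕ} (h : N ≤ t) :
    ∫ ω, (truncAge (receptions (fun i => X i ω) t) t N : ℝ) ∂P = meanTruncAge p N := by
  have hm : ∀ i, Measurable fun ω => (fun (ω : Ω) (i : ℕ) => X i ω) ω i := hX.measurable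
  simp only [truncAge, Nat.cast_sum, Nat.cast_ite, Nat.cast_one, Nat.cast_zero]
  rw [integral_finsetSum _ fun a _ => integrable_comp_receptions hm t
    (fun A => if recent A t a ≤ 1 then (1 : ℝ) else 0)]
  refine Finset.sum_congr rfl fun a ha => ?_
  exact hX.integral_recent_le_one hp0 hp1 ((Finset.mem_range.1 ha).trans_le h)

end Bernoulli

/-! ### Long-run averages -/

section Averages

lemma sum_period {f : ℕ → ℝ} {T N : ℕ} (hf : ∀ t, N ≤ t → f (t + T) = f t) {n : ℕ} (hn : N ≤ n) :
    ∑ r ∈ Finset.range T, f (n + r) = ∑ r ∈ Finset.range T, f (N + r) := by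
  induction n, hn using Nat.le_induction with
  | base => rfl
  | succ n hn ih =>
    have h1 := Finset.sum_range_succ (fun r => f (n + r)) T
    have h2 := Finset.sum_range_succ' (fun r => f (n + r)) T
    rw [hf n hn] at h1
    simp only [add_zero] at h2
    simp only [add_assoc, add_comm 1] at h2 ⊢
    linarith

/-- The averages of an eventually periodic sequence converge to the average over one period. -/
lemma tendsto_average_of_periodic {f : ℕ → ℝ} {T N : ℕ} (hT : 0 < T)
    (hf : ∀ t, N ≤ t → f (t + T) = f t) :
    Tendsto (fun n : ℕ => (∑ t ∈ Finset.range n, f t) / n) atTop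
      (𝓝 ((∑ r ∈ Finset.range T, f (N + r)) / T)) := by
  have hT' : (T : ℝ) ≠ 0 := by positivity
  set c := (∑ r ∈ Finset.range T, f (N + r)) / T with hc
  -- The deviation of the sums from `n * c` is eventually periodic, hence bounded.
  set g : ℕ → ℝ := fun n => ∑ t ∈ Finset.range n, f t - n * c with hg
  have hper : ∀ n, N ≤ n → g (n + T) = g n := fun n hn => by
    simp only [hg]
    rw [Finset.sum_range_add, sum_period hf hn, hc]
    push_cast
    field_simp
    ring
  set C := ∑ j ∈ Finset.range (N + T), |g j| with hC
  have hbound : ∀ n, |g n| ≤ C := fun n => by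
    induction n using Nat.strong_induction_on with
    | _ n ih =>
      by_cases h : n < N + T
      · exact Finset.single_le_sum (f := fun j => |g j|) (fun _ _ => abs_nonneg _)
          (Finset.mem_range.2 h)
      · obtain ⟨m, rfl⟩ : ∃ m, n = m + T := ⟨n - T, by omega⟩
        rw [hper m (by omega)]
        exact ih m (by omega)
  have hzero : Tendsto (fun n : ℕ => g n / n) atTop (𝓝 0) := by
    refine squeeze_zero_norm (fun n => ?_) (tendsto_const_div_atTop_nhds_zero_nat C)
    rw [norm_div, Real.norm_natCast, Real.norm_eq_abs]
    exact div_le_div_of_nonneg_right (hbound n) (Nat.cast_nonneg n)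
  have h := hzero.const_add c
  rw [add_zero] at h
  refine h.congr' ?_
  filter_upwards [eventually_gt_atTop 0] with n hn
  have hn' : (n : ℝ) ≠ 0 := by positivity
  simp only [hg]
  field_simp
  ring

lemma tendsto_average {f : ℕ → ℝ} {l : ℝ} (hf : Tendsto f atTop (𝓝 l)) :
    Tendsto (fun n : ℕ => (∑ t ∈ Finset.range n, f t) / n) atTop (𝓝 l) :=
  hf.cesaro.congr fun n => by rw [div_eq_inv_mul]

variable {Ω : Type*} [MeasurableSpace Ω] {P : Measure Ω}

open Classical in
/-- The averages of a system are determined by the long-run averages of the expected age, of the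
expected peak in a slot, and of the probability of a valid reception. -/
lemma averagesExist_and_eq [IsFiniteMeasure P] {m : ℕ} {S : Ω → Fin m → ℕ → ℕ}
    (hS : ∀ k i, Measurable fun ω => S ω k i) {δ₀ : ℕ} {α ε ν : ℝ}
    (hα : Tendsto (fun n : ℕ => (∑ t ∈ Finset.range n, ∫ ω, (age (S ω) δ₀ t : ℝ) ∂P) / n)
      atTop (𝓝 α))
    (hε : Tendsto (fun n : ℕ => (∑ t ∈ Finset.range n,
      ∫ ω, (if ValidAt (S ω) δ₀ t then (age (S ω) δ₀ t : ℝ) else 0) ∂P) / n) atTop (𝓝 ε))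
    (hν : Tendsto (fun n : ℕ => (∑ t ∈ Finset.range n,
      ∫ ω, (if ValidAt (S ω) δ₀ t then (1 : ℝ) else 0) ∂P) / n) atTop (𝓝 ν))
    (hν0 : ν ≠ 0) :
    AveragesExist P S δ₀ ∧ avgAoI P S δ₀ = α ∧ avgPAoI P S δ₀ = ε / ν := by
  have hpeak : ∀ n, (fun ω => (peakSum (S ω) δ₀ n : ℝ)) = fun ω => ∑ t ∈ Finset.range n,
      if ValidAt (S ω) δ₀ t then (age (S ω) δ₀ t : ℝ) else 0 := fun n => by
    ext ω; simp [peakSum]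
  have hcount : ∀ n, (fun ω => (validCount (S ω) δ₀ n : ℝ)) = fun ω => ∑ t ∈ Finset.range n,
      if ValidAt (S ω) δ₀ t then (1 : ℝ) else 0 := fun n => by
    ext ω; simp [validCount]
  have h1 : Tendsto (meanAoI P S δ₀) atTop (𝓝 α) := hα
  have h2 : Tendsto (meanPAoI P S δ₀) atTop (𝓝 (ε / ν)) := by
    refine (hε.div hν hν0).congr' ?_
    filter_upwards [eventually_gt_atTop 0] with n hn
    have hn' : (n : ℝ) ≠ 0 := by positivity
    simp only [meanPAoI, hpeak, hcount, Pi.div_apply]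
    rw [integral_finsetSum _ fun t _ => integrable_peak hS δ₀ t,
      integral_finsetSum _ fun t _ => integrable_valid hS δ₀ t, div_div_div_cancel_right₀ hn']
  have e1 : avgAoI P S δ₀ = α := h1.limUnder_eq
  have e2 : avgPAoI P S δ₀ = ε / ν := h2.limUnder_eq
  refine ⟨⟨integrable_age hS δ₀, fun n => ?_, fun n => ?_, e1 ▸ h1, e2 ▸ h2⟩, e1, e2⟩
  · rw [hpeak]
    exact integrable_finsetSum _ fun t _ => integrable_peak hS δ₀ t
  · rw [hcount]
    exact integrable_finsetSum _ fun t _ => integrable_valid hS δ₀ t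

end Averages

/-! ### Closed forms of geometric sums -/

section ClosedForms

lemma meanTruncAge_eq {p : ℝ} (hp : p ≠ 0) (N : ℕ) :
    meanTruncAge p N = 2 * (1 - (1 - p) ^ N) / p - N * (1 - p) ^ (N - 1) := by
  induction N with
  | zero => simp [meanTruncAge]
  | succ N ih =>
    rw [meanTruncAge, Finset.sum_range_succ, ← meanTruncAge, ih, atMostOneProb]
    cases N with
    | zero => simp; field_simp; ring
    | succ N =>
      simp only [Nat.add_sub_cancel]
      push_cast
      field_simp
      ring

lemma tendsto_meanTruncAge {p : ℝ} (hp0 : 0 < p) (hp1 : p < 1) :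
    Tendsto (meanTruncAge p) atTop (𝓝 (2 / p)) := by
  have hq0 : 0 < 1 - p := by linarith
  have h1 := tendsto_pow_atTop_nhds_zero_of_lt_one hq0.le (by linarith : 1 - p < 1)
  have h2 := (tendsto_self_mul_const_pow_of_lt_one hq0.le (by linarith : 1 - p < 1)).div_const
    (1 - p)
  have h3 := (((h1.const_sub 1).const_mul 2).div_const p).sub h2
  refine (h3.congr' ?_).trans (by simp)
  filter_upwards [eventually_gt_atTop 0] with N hN
  obtain ⟨n, rfl⟩ : ∃ n, N = n + 1 := ⟨N - 1, by omega⟩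
  rw [meanTruncAge_eq hp0.ne', Nat.add_sub_cancel]
  field_simp
  ring

/-- Closed form of the geometric sum over one period of the linear terms. -/
lemma sum_mul_pow_eq {p : ℝ} (hp : p ≠ 0) (T M : ℕ) :
    ∑ r ∈ Finset.range M, ((T + r + 1 : ℕ) : ℝ) * (1 - p) ^ (T + r) =
      (1 - p) ^ T * ((T + 1) / p + (1 - p) / p ^ 2) -
        (1 - p) ^ (T + M) * ((T + M + 1) / p + (1 - p) / p ^ 2) := by
  induction M with
  | zero => simp
  | succ M ih =>
    rw [Finset.sum_range_succ, ih]
    push_cast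
    field_simp
    ring

lemma sum_pow_eq {p : ℝ} (hp : p ≠ 0) (T M : ℕ) :
    ∑ r ∈ Finset.range M, (1 - p) ^ (T + r) = ((1 - p) ^ T - (1 - p) ^ (T + M)) / p := by
  induction M with
  | zero => simp
  | succ M ih =>
    rw [Finset.sum_range_succ, ih]
    field_simp
    ring

lemma sum_meanTruncAge_eq {p : ℝ} (hp : p ≠ 0) (T M : ℕ) :
    ∑ r ∈ Finset.range M, meanTruncAge p (T + r + 1) =
      2 * M / p - 2 * (1 - p) * ((1 - p) ^ T - (1 - p) ^ (T + M)) / p ^ 2 -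
        ((1 - p) ^ T * ((T + 1) / p + (1 - p) / p ^ 2) -
          (1 - p) ^ (T + M) * ((T + M + 1) / p + (1 - p) / p ^ 2)) := by
  simp only [meanTruncAge_eq hp, Nat.add_sub_cancel]
  rw [Finset.sum_sub_distrib, sum_mul_pow_eq hp]
  congr 1
  have : ∀ r, 2 * (1 - (1 - p) ^ (T + r + 1)) / p =
      2 / p - 2 * (1 - p) / p * (1 - p) ^ (T + r) := fun r => by
    field_simp
    ring
  simp only [this]
  rw [Finset.sum_sub_distrib, ← Finset.mul_sum, sum_pow_eq hp]
  simp only [Finset.sum_const, Finset.card_range, nsmul_eq_mul]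
  field_simp

end ClosedForms

/-! ### The averages of the three systems -/

section Systems

variable {Ω : Type*} [MeasurableSpace Ω] {P : Measure Ω} [IsProbabilityMeasure P]
  {X : ℕ → Ω → ℕ} {p : ℝ}

lemma receptions_eq_empty_iff {s : ℕ → ℕ} (hs : ∀ i, 0 < s i) {t : ℕ} :
    receptions s t = ∅ ↔ recent (receptions s t) t (t - 1) = 0 := by
  rw [recent, Finset.card_eq_zero, Finset.filter_true_of_mem]
  intro x hx
  have h1 : x ≠ 0 := by
    rintro rfl
    exact not_isReception_zero hs (isReception_iff.2 (mem_receptions.1 hx).2)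
  omega

lemma IsGeometricService.integral_age_zwGeo (hX : IsGeometricService P X p) (hp0 : 0 < p)
    (hp1 : p < 1) (δ₀ : ℕ) {t : ℕ} (ht : 0 < t) :
    ∫ ω, (age (zwGeo X ω) δ₀ t : ℝ) ∂P = meanTruncAge p t + δ₀ * (1 - p) ^ (t - 1) := by
  have hm : ∀ i, Measurable fun ω => (fun (ω : Ω) (i : ℕ) => X i ω) ω i := hX.measurable
  rw [← hX.integral_truncAge hp0 hp1 le_rfl,
    ← hX.integral_recent_eq_zero hp0 hp1 (Nat.sub_lt ht one_pos), ← integral_const_mul,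
    ← integral_add (integrable_comp_receptions hm t fun A => (truncAge A t t : ℝ))
      ((integrable_comp_receptions hm t
        fun A => if recent A t (t - 1) = 0 then (1 : ℝ) else 0).const_mul _)]
  refine integral_congr_ae ?_
  filter_upwards [hX.ae_pos hp0 hp1] with ω hω
  rw [zwGeo, age_single hω]
  simp only [receptions_eq_empty_iff hω]
  split_ifs <;> simp

open Classical in
/-- The correction term accounts for the first update, which is not valid if `δ₀ = 0`. -/
lemma IsGeometricService.integral_valid_zwGeo (hX : IsGeometricService P X p) (hp0 : 0 < p)
    (hp1 : p < 1) (δ₀ : ℕ) {t : ℕ} (ht : 0 < t) :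
    ∫ ω, (if ValidAt (zwGeo X ω) δ₀ t then (1 : ℝ) else 0) ∂P =
      p * (1 - (if δ₀ = 0 then 1 else 0) * (1 - p) ^ (t - 1)) := by
  have hm : ∀ i, Measurable fun ω => (fun (ω : Ω) (i : ℕ) => X i ω) ω i := hX.measurable
  have hi := hX.integral_ite_isReception hp0 hp1 ht
    (fun A => 1 - (if δ₀ = 0 then 1 else 0) * if recent A t (t - 1) = 0 then 1 else 0) (fun _ => 0)
  rw [integral_zero, mul_zero, add_zero, integral_sub (integrable_const _)
    ((integrable_comp_receptions hm t
        fun A => if recent A t (t - 1) = 0 then (1 : ℝ) else 0).const_mul _),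
    integral_const_mul, hX.integral_recent_eq_zero hp0 hp1 (Nat.sub_lt ht one_pos)] at hi
  rw [integral_const, probReal_univ, one_smul] at hi
  rw [← hi]
  refine integral_congr_ae ?_
  filter_upwards [hX.ae_pos hp0 hp1] with ω hω
  simp only [zwGeo, validAt_single hω, receptions_eq_empty_iff hω]
  by_cases h1 : IsReception (fun i => X i ω) t <;>
    by_cases h2 : recent (receptions (fun i => X i ω) t) t (t - 1) = 0 <;>
    by_cases h3 : δ₀ = 0 <;> simp [h1, h2, h3]

open Classical in
lemma IsGeometricService.integral_peak_zwGeo (hX : IsGeometricService P X p) (hp0 : 0 < p)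
    (hp1 : p < 1) (δ₀ : ℕ) {t : ℕ} (ht : 0 < t) :
    ∫ ω, (if ValidAt (zwGeo X ω) δ₀ t then (age (zwGeo X ω) δ₀ t : ℝ) else 0) ∂P =
      p * (meanTruncAge p t + (δ₀ - if δ₀ = 0 then (t : ℝ) else 0) * (1 - p) ^ (t - 1)) := by
  have hm : ∀ i, Measurable fun ω => (fun (ω : Ω) (i : ℕ) => X i ω) ω i := hX.measurable
  have hi := hX.integral_ite_isReception hp0 hp1 ht
    (fun A => truncAge A t t + (δ₀ - if δ₀ = 0 then (t : ℝ) else 0) *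
      if recent A t (t - 1) = 0 then 1 else 0) (fun _ => 0)
  rw [integral_zero, mul_zero, add_zero,
    integral_add (integrable_comp_receptions hm t fun A => (truncAge A t t : ℝ))
    ((integrable_comp_receptions hm t
        fun A => if recent A t (t - 1) = 0 then (1 : ℝ) else 0).const_mul _),
    integral_const_mul, hX.integral_recent_eq_zero hp0 hp1 (Nat.sub_lt ht one_pos),
    hX.integral_truncAge hp0 hp1 le_rfl] at hi
  rw [← hi]
  refine integral_congr_ae ?_
  filter_upwards [hX.ae_pos hp0 hp1] with ω hω
  simp only [zwGeo, validAt_single hω, age_single hω, receptions_eq_empty_iff hω]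
  by_cases h1 : IsReception (fun i => X i ω) t <;>
    by_cases h2 : recent (receptions (fun i => X i ω) t) t (t - 1) = 0 <;>
    by_cases h3 : δ₀ = 0 <;> simp [h1, h2, h3]
  -- The case left is that of the first update with `δ₀ = 0`, when the age is `t`.
  have := truncAge_eq_self (h2.le.trans zero_le_one)
  simp [this]

/-- Both averages of ZW/Geo/1 are `2 / p`. -/
lemma IsGeometricService.averages_zwGeo (hX : IsGeometricService P X p) (hp0 : 0 < p)
    (hp1 : p < 1) (δ₀ : ℕ) :
    AveragesExist P (zwGeo X) δ₀ ∧ avgAoI P (zwGeo X) δ₀ = 2 / p ∧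
      avgPAoI P (zwGeo X) δ₀ = 2 / p := by
  have hS : ∀ k i, Measurable fun ω => zwGeo X ω k i := fun k i => by
    simpa [zwGeo] using hX.measurable i
  have hq0 : 0 < 1 - p := by linarith
  have hq1 : 1 - p < 1 := by linarith
  have hA := tendsto_meanTruncAge hp0 hp1
  have hpow : Tendsto (fun t : ℕ => (1 - p) ^ (t - 1)) atTop (𝓝 0) :=
    (tendsto_pow_atTop_nhds_zero_of_lt_one hq0.le hq1).comp (tendsto_sub_atTop_nat 1)
  have hmul : Tendsto (fun t : ℕ => (t : ℝ) * (1 - p) ^ (t - 1)) atTop (𝓝 0) := by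
    have h := (tendsto_self_mul_const_pow_of_lt_one hq0.le hq1).div_const (1 - p)
    rw [zero_div] at h
    refine h.congr' ?_
    filter_upwards [eventually_gt_atTop 0] with N hN
    obtain ⟨n, rfl⟩ : ∃ n, N = n + 1 := ⟨N - 1, by omega⟩
    rw [Nat.add_sub_cancel, pow_succ]
    field_simp
  have hα : Tendsto (fun t => ∫ ω, (age (zwGeo X ω) δ₀ t : ℝ) ∂P) atTop (𝓝 (2 / p)) := by
    have h := hA.add (hpow.const_mul (δ₀ : ℝ))
    rw [mul_zero, add_zero] at h
    refine h.congr' ?_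
    filter_upwards [eventually_gt_atTop 0] with t ht
    exact (hX.integral_age_zwGeo hp0 hp1 δ₀ ht).symm
  classical
  have hν : Tendsto (fun t => ∫ ω, (if ValidAt (zwGeo X ω) δ₀ t then (1 : ℝ) else 0) ∂P) atTop
      (𝓝 p) := by
    have h := ((hpow.const_mul (if δ₀ = 0 then (1 : ℝ) else 0)).const_sub 1).const_mul p
    rw [mul_zero, sub_zero, mul_one] at h
    refine h.congr' ?_
    filter_upwards [eventually_gt_atTop 0] with t ht
    exact (hX.integral_valid_zwGeo hp0 hp1 δ₀ ht).symm
  have hε : Tendsto (fun t => ∫ ω, (if ValidAt (zwGeo X ω) δ₀ t then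
      (age (zwGeo X ω) δ₀ t : ℝ) else 0) ∂P) atTop (𝓝 2) := by
    have h := ((hA.add (hpow.const_mul (δ₀ : ℝ))).sub
      (hmul.const_mul (if δ₀ = 0 then (1 : ℝ) else 0))).const_mul p
    rw [mul_zero, mul_zero, add_zero, sub_zero, mul_div_cancel₀ _ hp0.ne'] at h
    refine h.congr' ?_
    filter_upwards [eventually_gt_atTop 0] with t ht
    rw [hX.integral_peak_zwGeo hp0 hp1 δ₀ ht]
    split_ifs <;> ring
  exact averagesExist_and_eq hS (tendsto_average hα) (tendsto_average hε) (tendsto_average hν)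
    hp0.ne'

lemma dAge_add_self {T t : ℕ} (ht : T + 1 ≤ t) : dAge T (t + T) = dAge T t := by
  have : t + T - 1 = (t - 1) + T := by omega
  rw [dAge, this, Nat.add_mod_right, dAge]

lemma dAge_period {T r : ℕ} (hr : r < T) : dAge T (T + 1 + r) = T + r + 1 := by
  have : T + 1 + r - 1 = r + T := by omega
  rw [dAge, this, Nat.add_mod_right, Nat.mod_eq_of_lt hr]

lemma dvd_period_iff {T r : ℕ} (hr : r < T) : T ∣ T + 1 + r ↔ r + 1 = T := by
  rw [add_assoc, Nat.dvd_add_right (dvd_refl T)]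
  constructor
  · intro h
    have := Nat.le_of_dvd (by omega) h
    omega
  · intro h
    rw [add_comm, h]

/-- In the period `T + 1, …, 2 * T` the only multiple of `T` is the last slot. -/
lemma sum_period_ite {T : ℕ} (hT : 0 < T) (f : ℕ → ℝ) (c : ℝ) :
    ∑ r ∈ Finset.range T, (if T ∣ T + 1 + r then c else f r) =
      ∑ r ∈ Finset.range (T - 1), f r + c := by
  obtain ⟨n, rfl⟩ : ∃ n, T = n + 1 := ⟨T - 1, by omega⟩
  rw [Finset.sum_range_succ, Nat.add_sub_cancel, if_pos ((dvd_period_iff (by omega)).2 rfl)]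
  congr 1
  refine Finset.sum_congr rfl fun r hr => if_neg ?_
  rw [Finset.mem_range] at hr
  rw [dvd_period_iff (by omega)]
  omega

/-- The averages of ZW/D/1. -/
lemma averages_zwD {T : ℕ} (hT : 0 < T) (δ₀ : ℕ) :
    AveragesExist P (zwD Ω T) δ₀ ∧ avgAoI P (zwD Ω T) δ₀ = (3 * T + 1) / 2 ∧
      avgPAoI P (zwD Ω T) δ₀ = 2 * T := by
  classical
  have hT' : (T : ℝ) ≠ 0 := by positivity
  have hS : ∀ k i, Measurable fun ω => zwD Ω T ω k i := fun k i => measurable_const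
  have hα : ∀ t, T + 1 ≤ t → ∫ ω, (age (zwD Ω T ω) δ₀ t : ℝ) ∂P = dAge T t := fun t ht => by
    simp only [zwD, age_const hT ht]
    simp
  have hν : ∀ t, T + 1 ≤ t → ∫ ω, (if ValidAt (zwD Ω T ω) δ₀ t then (1 : ℝ) else 0) ∂P =
      if T ∣ t then 1 else 0 := fun t ht => by
    simp only [zwD, validAt_const hT ht]
    simp
  have hε : ∀ t, T + 1 ≤ t → ∫ ω, (if ValidAt (zwD Ω T ω) δ₀ t then
      (age (zwD Ω T ω) δ₀ t : ℝ) else 0) ∂P = if T ∣ t then 2 * (T : ℝ) else 0 := fun t ht => by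
    simp only [zwD, validAt_const hT ht, age_const hT ht]
    split_ifs with h
    · simp [dAge_of_dvd hT ht h]
    · simp
  have h1 := tendsto_average_of_periodic (N := T + 1) hT (f := fun t =>
    ∫ ω, (age (zwD Ω T ω) δ₀ t : ℝ) ∂P)
    fun t ht => by rw [hα t ht, hα _ (by omega), dAge_add_self ht]
  have h2 := tendsto_average_of_periodic (N := T + 1) hT (f := fun t =>
    ∫ ω, (if ValidAt (zwD Ω T ω) δ₀ t then (age (zwD Ω T ω) δ₀ t : ℝ) else 0) ∂P)
    fun t ht => by simp only [hε t ht, hε _ (ht.trans (Nat.le_add_right t T)),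
      Nat.dvd_add_self_right]
  have h3 := tendsto_average_of_periodic (N := T + 1) hT (f := fun t =>
    ∫ ω, (if ValidAt (zwD Ω T ω) δ₀ t then (1 : ℝ) else 0) ∂P)
    fun t ht => by simp only [hν t ht, hν _ (ht.trans (Nat.le_add_right t T)),
      Nat.dvd_add_self_right]
  simp only [hν _ (Nat.le_add_right (T + 1) _), sum_period_ite hT (fun _ => (0 : ℝ)),
    Finset.sum_const_zero, zero_add] at h3
  simp only [hε _ (Nat.le_add_right (T + 1) _), sum_period_ite hT (fun _ => (0 : ℝ)),
    Finset.sum_const_zero, zero_add] at h2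
  have hsum : ∑ r ∈ Finset.range T, ∫ ω, (age (zwD Ω T ω) δ₀ (T + 1 + r) : ℝ) ∂P =
      T * ((3 * T + 1) / 2) := by
    rw [Finset.sum_congr rfl (g := fun r : ℕ => ((T : ℝ) + 1) + r)]
    · rw [Finset.sum_add_distrib, Finset.sum_const, Finset.card_range, nsmul_eq_mul,
        ← Nat.cast_sum]
      have h := congrArg (Nat.cast (R := ℝ)) (Finset.sum_range_id_mul_two T)
      push_cast [Nat.cast_sub (Nat.one_le_of_lt hT)] at h ⊢
      linarith
    · intro r hr
      rw [hα _ (by omega), dAge_period (Finset.mem_range.1 hr)]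
      push_cast
      ring
  rw [hsum, mul_div_cancel_left₀ _ hT'] at h1
  obtain ⟨ha, hb, hc⟩ := averagesExist_and_eq hS h1 h2 h3 (by positivity)
  refine ⟨ha, hb, hc.trans ?_⟩
  field_simp

lemma IsGeometricService.integral_age_geoD (hX : IsGeometricService P X p) (hp0 : 0 < p)
    (hp1 : p < 1) (δ₀ : ℕ) {T t : ℕ} (hT : 0 < T) (ht : T < t) :
    ∫ ω, (age (geoD X T ω) δ₀ t : ℝ) ∂P = meanTruncAge p (dAge T t) := by
  rw [← hX.integral_truncAge hp0 hp1 (dAge_le hT ht)]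
  refine integral_congr_ae ?_
  filter_upwards [hX.ae_pos hp0 hp1] with ω hω
  rw [geoD, age_pair hω hT ht]

open Classical in
lemma IsGeometricService.integral_valid_geoD (hX : IsGeometricService P X p) (hp0 : 0 < p)
    (hp1 : p < 1) (δ₀ : ℕ) {T t : ℕ} (hT : 0 < T) (ht : T < t) :
    ∫ ω, (if ValidAt (geoD X T ω) δ₀ t then (1 : ℝ) else 0) ∂P =
      if T ∣ t then p + (1 - p) * atMostOneProb p T else p * (1 - (1 - p) ^ (dAge T t - 1)) := by
  have hm : ∀ i, Measurable fun ω => (fun (ω : Ω) (i : ℕ) => X i ω) ω i := hX.measurable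
  have hle := dAge_le hT ht
  split_ifs with hd
  · have hi := hX.integral_ite_isReception hp0 hp1 (t := t) (by omega) (fun _ => 1)
      (fun A => if recent A t T ≤ 1 then 1 else 0)
    rw [integral_const, probReal_univ, one_smul, mul_one,
      hX.integral_recent_le_one hp0 hp1 ht] at hi
    rw [← hi]
    refine integral_congr_ae ?_
    filter_upwards [hX.ae_pos hp0 hp1] with ω hω
    simp only [geoD, validAt_pair_of_dvd hω hT ht hd]
    by_cases h1 : IsReception (fun i => X i ω) t <;> simp [h1]
  · have hi := hX.integral_ite_isReception hp0 hp1 (t := t) (by omega)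
      (fun A => 1 - if recent A t (dAge T t - 1) = 0 then 1 else 0) (fun _ => 0)
    rw [integral_zero, mul_zero, add_zero, integral_sub (integrable_const _)
      (integrable_comp_receptions hm t
        fun A => if recent A t (dAge T t - 1) = 0 then (1 : ℝ) else 0),
      hX.integral_recent_eq_zero hp0 hp1 (by omega), integral_const, probReal_univ, one_smul] at hi
    rw [← hi]
    refine integral_congr_ae ?_
    filter_upwards [hX.ae_pos hp0 hp1] with ω hω
    simp only [geoD, validAt_pair_of_not_dvd hω hT ht hd]
    by_cases h1 : IsReception (fun i => X i ω) t <;>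
      by_cases h2 : recent (receptions (fun i => X i ω) t) t (dAge T t - 1) = 0 <;> simp [h1, h2]

open Classical in
lemma IsGeometricService.integral_peak_geoD (hX : IsGeometricService P X p) (hp0 : 0 < p)
    (hp1 : p < 1) (δ₀ : ℕ) {T t : ℕ} (hT : 0 < T) (ht : T < t) :
    ∫ ω, (if ValidAt (geoD X T ω) δ₀ t then (age (geoD X T ω) δ₀ t : ℝ) else 0) ∂P =
      if T ∣ t then p * meanTruncAge p (2 * T) +
        (1 - p) * (meanTruncAge p (2 * T) - meanTruncAge p T + T * atMostOneProb p T)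
      else p * (meanTruncAge p (dAge T t) - dAge T t * (1 - p) ^ (dAge T t - 1)) := by
  have hm : ∀ i, Measurable fun ω => (fun (ω : Ω) (i : ℕ) => X i ω) ω i := hX.measurable
  have hle := dAge_le hT ht
  have htr : ∀ N, Integrable (fun ω => (truncAge (receptions (fun i => X i ω) t) t N : ℝ)) P :=
    fun N => integrable_comp_receptions hm t fun A => (truncAge A t N : ℝ)
  split_ifs with hd
  -- Without a reception from the geometric sensor, the peak counts only if the age exceeds `T`;
  -- the age restricted to this event is its excess over its truncation at `T`, plus `T`.
  · have h2T : 2 * T ≤ t := dAge_of_dvd hT ht hd ▸ hle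
    have hi := hX.integral_ite_isReception hp0 hp1 (t := t) (by omega)
      (fun A => (truncAge A t (2 * T) : ℝ))
      (fun A => (truncAge A t (2 * T) : ℝ) - truncAge A t T +
        T * if recent A t T ≤ 1 then 1 else 0)
    have hsub : Integrable (fun ω => (truncAge (receptions (fun i => X i ω) t) t (2 * T) : ℝ) -
        truncAge (receptions (fun i => X i ω) t) t T) P := (htr _).sub (htr _)
    rw [integral_add hsub ((integrable_comp_receptions hm t
        fun A => if recent A t T ≤ 1 then (1 : ℝ) else 0).const_mul _),
      integral_sub (htr _) (htr _), integral_const_mul, hX.integral_recent_le_one hp0 hp1 ht,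
      hX.integral_truncAge hp0 hp1 h2T, hX.integral_truncAge hp0 hp1 ht.le] at hi
    rw [← hi]
    refine integral_congr_ae ?_
    filter_upwards [hX.ae_pos hp0 hp1] with ω hω
    simp only [geoD, validAt_pair_of_dvd hω hT ht hd, age_pair hω hT ht, dAge_of_dvd hT ht hd]
    by_cases h1 : IsReception (fun i => X i ω) t
    · simp [h1]
    · by_cases h2 : recent (receptions (fun i => X i ω) t) t T ≤ 1
      · have := truncAge_eq_self ((recent_mono _ t (Nat.sub_le T 1)).trans h2)
        simp [h1, h2, this]
      · have := truncAge_eq_of_two_le_recent (by omega : T ≤ 2 * T) (not_le.1 h2)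
        simp [h1, h2, this]
  -- The update is not valid if the geometric sensor had no reception in the last `dAge T t - 1`
  -- slots; the age is `dAge T t` on this event.
  · have hi := hX.integral_ite_isReception hp0 hp1 (t := t) (by omega)
      (fun A => (truncAge A t (dAge T t) : ℝ) -
        dAge T t * if recent A t (dAge T t - 1) = 0 then 1 else 0) (fun _ => 0)
    rw [integral_zero, mul_zero, add_zero, integral_sub (htr _) ((integrable_comp_receptions hm t
        fun A => if recent A t (dAge T t - 1) = 0 then (1 : ℝ) else 0).const_mul _),
      integral_const_mul, hX.integral_recent_eq_zero hp0 hp1 (by omega),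
      hX.integral_truncAge hp0 hp1 hle] at hi
    rw [← hi]
    refine integral_congr_ae ?_
    filter_upwards [hX.ae_pos hp0 hp1] with ω hω
    simp only [geoD, validAt_pair_of_not_dvd hω hT ht hd, age_pair hω hT ht]
    by_cases h1 : IsReception (fun i => X i ω) t
    · by_cases h2 : recent (receptions (fun i => X i ω) t) t (dAge T t - 1) = 0
      · have := truncAge_eq_self (h2.le.trans zero_le_one)
        simp [h1, h2, this]
      · simp [h1, h2]
    · simp [h1]

/-- The averages of the Geo-D system as sums over one period of the deterministic sensor. -/
lemma IsGeometricService.averages_geoD (hX : IsGeometricService P X p) (hp0 : 0 < p)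
    (hp1 : p < 1) (δ₀ : ℕ) {T : ℕ} (hT : 0 < T) :
    AveragesExist P (geoD X T) δ₀ ∧
      avgAoI P (geoD X T) δ₀ = (∑ r ∈ Finset.range T, meanTruncAge p (T + r + 1)) / T ∧
      avgPAoI P (geoD X T) δ₀ =
        (∑ r ∈ Finset.range (T - 1),
            p * (meanTruncAge p (T + r + 1) - (T + r + 1 : ℕ) * (1 - p) ^ (T + r)) +
          (p * meanTruncAge p (2 * T) + (1 - p) *
            (meanTruncAge p (2 * T) - meanTruncAge p T + T * atMostOneProb p T))) /
        (∑ r ∈ Finset.range (T - 1), p * (1 - (1 - p) ^ (T + r)) +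
          (p + (1 - p) * atMostOneProb p T)) := by
  classical
  have hT' : (0 : ℝ) < T := by positivity
  have hq0 : 0 < 1 - p := by linarith
  have hS : ∀ k i, Measurable fun ω => geoD X T ω k i := fun k i => by
    fin_cases k
    · exact hX.measurable i
    · exact measurable_const
  have h1 := tendsto_average_of_periodic (N := T + 1) hT (f := fun t =>
    ∫ ω, (age (geoD X T ω) δ₀ t : ℝ) ∂P) fun t ht => by
      rw [hX.integral_age_geoD hp0 hp1 δ₀ hT ht, hX.integral_age_geoD hp0 hp1 δ₀ hT (by omega),
        dAge_add_self ht]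
  have h2 := tendsto_average_of_periodic (N := T + 1) hT (f := fun t =>
    ∫ ω, (if ValidAt (geoD X T ω) δ₀ t then (age (geoD X T ω) δ₀ t : ℝ) else 0) ∂P)
    fun t ht => by
      rw [hX.integral_peak_geoD hp0 hp1 δ₀ hT ht, hX.integral_peak_geoD hp0 hp1 δ₀ hT (by omega),
        dAge_add_self ht]
      simp only [Nat.dvd_add_self_right]
  have h3 := tendsto_average_of_periodic (N := T + 1) hT (f := fun t =>
    ∫ ω, (if ValidAt (geoD X T ω) δ₀ t then (1 : ℝ) else 0) ∂P) fun t ht => by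
      rw [hX.integral_valid_geoD hp0 hp1 δ₀ hT ht, hX.integral_valid_geoD hp0 hp1 δ₀ hT (by omega),
        dAge_add_self ht]
      simp only [Nat.dvd_add_self_right]
  rw [Finset.sum_congr rfl (g := fun r => meanTruncAge p (T + r + 1)) fun r hr => by
    rw [hX.integral_age_geoD hp0 hp1 δ₀ hT (by omega), dAge_period (Finset.mem_range.1 hr)]] at h1
  rw [Finset.sum_congr rfl fun r hr => by
    rw [hX.integral_peak_geoD hp0 hp1 δ₀ hT (by omega), dAge_period (Finset.mem_range.1 hr),
      Nat.add_sub_cancel], sum_period_ite hT] at h2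
  rw [Finset.sum_congr rfl fun r hr => by
    rw [hX.integral_valid_geoD hp0 hp1 δ₀ hT (by omega), dAge_period (Finset.mem_range.1 hr),
      Nat.add_sub_cancel], sum_period_ite hT] at h3
  have hpos : 0 < (∑ r ∈ Finset.range (T - 1), p * (1 - (1 - p) ^ (T + r)) +
      (p + (1 - p) * atMostOneProb p T)) := by
    have ha : 0 ≤ ∑ r ∈ Finset.range (T - 1), p * (1 - (1 - p) ^ (T + r)) :=
      Finset.sum_nonneg fun r _ => mul_nonneg hp0.le
        (sub_nonneg.2 (pow_le_one₀ hq0.le (by linarith)))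
    have hb : 0 ≤ atMostOneProb p T := by unfold atMostOneProb; positivity
    have hc := mul_nonneg hq0.le hb
    linarith
  obtain ⟨ha, hb, hc⟩ := averagesExist_and_eq hS h1 h2 h3 (by positivity)
  refine ⟨ha, hb, hc.trans ?_⟩
  rw [div_div_div_cancel_right₀ hT'.ne']

end Systems

/-! ### Limits as the service rate tends to zero -/

section Limits

lemma tendsto_one_sub_inv_pow :
    Tendsto (fun T : ℕ => (1 - 1 / (T : ℝ)) ^ T) atTop (𝓝 (Real.exp 1)⁻¹) := by
  rw [← Real.exp_neg]
  refine (Real.tendsto_one_add_div_pow_exp (-1)).congr fun T => ?_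
  rw [neg_div, ← sub_eq_add_neg]

lemma tendsto_one_sub_inv_pow_pred :
    Tendsto (fun T : ℕ => (1 - 1 / (T : ℝ)) ^ (T - 1)) atTop (𝓝 (Real.exp 1)⁻¹) := by
  have h := tendsto_one_sub_inv_pow.div
    (tendsto_one_div_atTop_nhds_zero_nat.const_sub (1 : ℝ)) (by norm_num)
  rw [sub_zero, div_one] at h
  refine h.congr' ?_
  filter_upwards [eventually_ge_atTop 2] with T hT
  have hT' : (2 : ℝ) ≤ T := by exact_mod_cast hT
  have hlt : 1 / (T : ℝ) < 1 := by
    rw [div_lt_one (by positivity)]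
    linarith
  have hq : (1 : ℝ) - 1 / T ≠ 0 := (sub_pos.2 hlt).ne'
  obtain ⟨n, rfl⟩ : ∃ n, T = n + 1 := ⟨T - 1, by omega⟩
  rw [Pi.div_apply, Nat.add_sub_cancel, pow_succ, mul_div_cancel_right₀ _ hq]

/-- The average age of Geo-D divided by `T`, as a function of `x = (1 - 1 / T) ^ T` and
`i = 1 / T`. -/
noncomputable def scaledAge (x i : ℝ) : ℝ :=
  2 - 2 * (1 - i) * (x - x * x) - x * (1 + i + (1 - i)) + x * x * (2 + i + (1 - i))

/-- The expected sum of the peaks of Geo-D over a period divided by `T`, as a function of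
`x = (1 - 1 / T) ^ T`, `y = (1 - 1 / T) ^ (T - 1)` and `i = 1 / T`. -/
noncomputable def scaledPeak (x y i : ℝ) : ℝ :=
  2 * (1 - i) - 2 * (1 - i) * (x - x * y) - 2 * x * (1 + i + (1 - i)) +
    2 * x * y * (2 + (1 - i)) + 2 * (1 - x * x) - 2 * x * y -
    (1 - i) * (2 * (1 - x) - 2 * y - x)

/-- The expected number of valid updates of Geo-D over a period, in the same variables. -/
noncomputable def periodCount (x y i : ℝ) : ℝ := 1 - x + x * y + (1 - i) * x + (1 - i) * y

variable {T : ℕ}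

lemma geoD_age_eq (hT : 2 ≤ T) :
    (∑ r ∈ Finset.range T, meanTruncAge (1 / (T : ℝ)) (T + r + 1)) / T =
      T * scaledAge ((1 - 1 / (T : ℝ)) ^ T) (1 / T) := by
  have hT' : (T : ℝ) ≠ 0 := by positivity
  rw [sum_meanTruncAge_eq (one_div_ne_zero hT'), pow_add]
  generalize (1 - 1 / (T : ℝ)) ^ T = x
  unfold scaledAge
  field_simp
  ring

lemma geoD_peak_eq (hT : 2 ≤ T) {p : ℝ} (hp : p = 1 / (T : ℝ)) :
    ∑ r ∈ Finset.range (T - 1),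
        p * (meanTruncAge p (T + r + 1) - (T + r + 1 : ℕ) * (1 - p) ^ (T + r)) +
      (p * meanTruncAge p (2 * T) + (1 - p) *
        (meanTruncAge p (2 * T) - meanTruncAge p T + T * atMostOneProb p T)) =
      T * scaledPeak ((1 - p) ^ T) ((1 - p) ^ (T - 1)) p := by
  have hT' : (T : ℝ) ≠ 0 := by positivity
  have hp0 : p ≠ 0 := hp ▸ one_div_ne_zero hT'
  have e1 : 2 * T - 1 = T + (T - 1) := by omega
  rw [← Finset.mul_sum, Finset.sum_sub_distrib, sum_meanTruncAge_eq hp0, sum_mul_pow_eq hp0,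
    meanTruncAge_eq hp0, meanTruncAge_eq hp0, atMostOneProb, e1, two_mul T, pow_add, pow_add,
    Nat.cast_sub (by omega : 1 ≤ T)]
  generalize (1 - p) ^ T = x
  generalize (1 - p) ^ (T - 1) = y
  subst hp
  unfold scaledPeak
  push_cast
  field_simp
  ring

lemma geoD_count_eq (hT : 2 ≤ T) {p : ℝ} (hp : p = 1 / (T : ℝ)) :
    ∑ r ∈ Finset.range (T - 1), p * (1 - (1 - p) ^ (T + r)) +
      (p + (1 - p) * atMostOneProb p T) =
      periodCount ((1 - p) ^ T) ((1 - p) ^ (T - 1)) p := by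
  have hT' : (T : ℝ) ≠ 0 := by positivity
  have hp0 : p ≠ 0 := hp ▸ one_div_ne_zero hT'
  rw [← Finset.mul_sum, Finset.sum_sub_distrib, sum_pow_eq hp0, atMostOneProb, pow_add,
    Finset.sum_const, Finset.card_range, nsmul_eq_mul, Nat.cast_sub (by omega : 1 ≤ T)]
  generalize (1 - p) ^ T = x
  generalize (1 - p) ^ (T - 1) = y
  subst hp
  unfold periodCount
  push_cast
  field_simp
  ring

lemma tendsto_scaledAge :
    Tendsto (fun T : ℕ => scaledAge ((1 - 1 / (T : ℝ)) ^ T) (1 / T)) atTop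
      (𝓝 (scaledAge (Real.exp 1)⁻¹ 0)) := by
  have hc : Continuous fun z : ℝ × ℝ => scaledAge z.1 z.2 := by unfold scaledAge; fun_prop
  have h := tendsto_one_sub_inv_pow.prodMk_nhds (tendsto_one_div_atTop_nhds_zero_nat (𝕜 := ℝ))
  have hlim := (hc.tendsto ((Real.exp 1)⁻¹, 0)).comp h
  exact hlim

lemma tendsto_scaledPeak_div_periodCount :
    Tendsto (fun T : ℕ =>
      scaledPeak ((1 - 1 / (T : ℝ)) ^ T) ((1 - 1 / (T : ℝ)) ^ (T - 1)) (1 / T) /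
        periodCount ((1 - 1 / (T : ℝ)) ^ T) ((1 - 1 / (T : ℝ)) ^ (T - 1)) (1 / T)) atTop
      (𝓝 (scaledPeak (Real.exp 1)⁻¹ (Real.exp 1)⁻¹ 0 /
        periodCount (Real.exp 1)⁻¹ (Real.exp 1)⁻¹ 0)) := by
  have h := tendsto_one_sub_inv_pow.prodMk_nhds
    (tendsto_one_sub_inv_pow_pred.prodMk_nhds (tendsto_one_div_atTop_nhds_zero_nat (𝕜 := ℝ)))
  have hc1 : Continuous fun z : ℝ × ℝ × ℝ => scaledPeak z.1 z.2.1 z.2.2 := by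
    unfold scaledPeak; fun_prop
  have hc2 : Continuous fun z : ℝ × ℝ × ℝ => periodCount z.1 z.2.1 z.2.2 := by
    unfold periodCount; fun_prop
  refine ((hc1.tendsto _).comp h).div ((hc2.tendsto _).comp h) ?_
  have := Real.exp_pos 1
  have h0 : periodCount (Real.exp 1)⁻¹ (Real.exp 1)⁻¹ 0 =
      1 + (Real.exp 1)⁻¹ + (Real.exp 1)⁻¹ * (Real.exp 1)⁻¹ := by
    unfold periodCount; ring
  change periodCount (Real.exp 1)⁻¹ (Real.exp 1)⁻¹ 0 ≠ 0
  rw [h0]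
  positivity

lemma reductionRatio_mul_left {c : ℝ} (hc : c ≠ 0) (a b : ℝ) :
    reductionRatio (c * a) (c * b) = reductionRatio a b := by
  rw [reductionRatio, reductionRatio, ← mul_sub, mul_div_mul_left _ _ hc]

lemma tendsto_reductionRatio {f g : ℕ → ℝ} {a b : ℝ} (hf : Tendsto f atTop (𝓝 a))
    (hg : Tendsto g atTop (𝓝 b)) (ha : a ≠ 0) :
    Tendsto (fun T => reductionRatio (f T) (g T)) atTop (𝓝 (reductionRatio a b)) :=
  (hf.sub hg).div hf ha

end Limits

/-! ### Numerical values -/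

section Numerics

lemma abs_sub_lt_of_exp_one_bounds :
    |2 / Real.exp 1 - 5 / (2 * Real.exp 1 ^ 2) - 0.3974| < 0.0001 ∧
    |8 / (3 * Real.exp 1) - 10 / (3 * Real.exp 1 ^ 2) - 1 / 3 - 0.1965| < 0.0001 ∧
    |(3 * Real.exp 1 - 2) / (2 * (Real.exp 1 ^ 2 + Real.exp 1 + 1)) - 0.2771| < 0.0001 := by
  have h1 := Real.exp_one_gt_d9
  have h2 := Real.exp_one_lt_d9
  set e := Real.exp 1 with he
  have he0 : 0 < e := by linarith
  have hx1 : 0.36787 < e⁻¹ := by rw [lt_inv_comm₀ (by norm_num) he0]; linarith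
  have hx2 : e⁻¹ < 0.36789 := by rw [inv_lt_comm₀ he0 (by norm_num)]; linarith
  have r1 : 2 / e - 5 / (2 * e ^ 2) = 2 * e⁻¹ - 5 / 2 * e⁻¹ ^ 2 := by field_simp
  have r2 : 8 / (3 * e) - 10 / (3 * e ^ 2) - 1 / 3 = 8 / 3 * e⁻¹ - 10 / 3 * e⁻¹ ^ 2 - 1 / 3 := by
    field_simp
  have hd : 0 < 2 * (e ^ 2 + e + 1) := by positivity
  refine ⟨?_, ?_, ?_⟩
  · rw [r1, abs_lt]
    constructor <;> nlinarith
  · rw [r2, abs_lt]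
    constructor <;> nlinarith
  · rw [abs_lt, lt_sub_iff_add_lt, sub_lt_iff_lt_add, lt_div_iff₀ hd, div_lt_iff₀ hd]
    constructor <;> nlinarith

end Numerics

/-! ### The reduction ratios -/

theorem mainTheorem5 {Ω : ℕ → Type*} [∀ T, MeasurableSpace (Ω T)]
    (P : ∀ T, Measure (Ω T)) [∀ T, IsProbabilityMeasure (P T)]
    (X : ∀ T, ℕ → Ω T → ℕ)
    (hX : ∀ T, 2 ≤ T → IsGeometricService (P T) (X T) (1 / (T : ℝ)))
    (δ₀ : ℕ) :
    (∀ T, 2 ≤ T →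
      AveragesExist (P T) (geoD (X T) T) δ₀ ∧
      AveragesExist (P T) (zwGeo (X T)) δ₀ ∧
      AveragesExist (P T) (zwD (Ω T) T) δ₀) ∧
    Tendsto (fun T => reductionRatio (avgAoI (P T) (zwGeo (X T)) δ₀)
        (avgAoI (P T) (geoD (X T) T) δ₀)) atTop
      (𝓝 (2 / Real.exp 1 - 5 / (2 * Real.exp 1 ^ 2))) ∧
    Tendsto (fun T => reductionRatio (avgAoI (P T) (zwD (Ω T) T) δ₀)
        (avgAoI (P T) (geoD (X T) T) δ₀)) atTop
      (𝓝 (8 / (3 * Real.exp 1) - 10 / (3 * Real.exp 1 ^ 2) - 1 / 3)) ∧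
    Tendsto (fun T => reductionRatio (avgPAoI (P T) (zwGeo (X T)) δ₀)
        (avgPAoI (P T) (geoD (X T) T) δ₀)) atTop
      (𝓝 ((3 * Real.exp 1 - 2) / (2 * (Real.exp 1 ^ 2 + Real.exp 1 + 1)))) ∧
    Tendsto (fun T => reductionRatio (avgPAoI (P T) (zwD (Ω T) T) δ₀)
        (avgPAoI (P T) (geoD (X T) T) δ₀)) atTop
      (𝓝 ((3 * Real.exp 1 - 2) / (2 * (Real.exp 1 ^ 2 + Real.exp 1 + 1)))) ∧
    |2 / Real.exp 1 - 5 / (2 * Real.exp 1 ^ 2) - 0.3974| < 0.0001 ∧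
    |8 / (3 * Real.exp 1) - 10 / (3 * Real.exp 1 ^ 2) - 1 / 3 - 0.1965| < 0.0001 ∧
    |(3 * Real.exp 1 - 2) / (2 * (Real.exp 1 ^ 2 + Real.exp 1 + 1)) - 0.2771| < 0.0001 := by
  have hp0 : ∀ T : ℕ, 2 ≤ T → 0 < 1 / (T : ℝ) := fun T hT => by positivity
  have hp1 : ∀ T : ℕ, 2 ≤ T → 1 / (T : ℝ) < 1 := fun T hT => by
    have : (2 : ℝ) ≤ T := by exact_mod_cast hT
    rw [div_lt_one (by positivity)]
    linarith
  have hne : ∀ T : ℕ, 2 ≤ T → (T : ℝ) ≠ 0 := fun T hT => by positivity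
  have hgeo := fun T hT => (hX T hT).averages_zwGeo (hp0 T hT) (hp1 T hT) δ₀
  have hdet := fun T (hT : 2 ≤ T) => averages_zwD (P := P T) (T := T) (by omega) δ₀
  have hpair := fun T hT => (hX T hT).averages_geoD (hp0 T hT) (hp1 T hT) δ₀ (T := T) (by omega)
  have hA : ∀ T, 2 ≤ T → avgAoI (P T) (geoD (X T) T) δ₀ =
      T * scaledAge ((1 - 1 / (T : ℝ)) ^ T) (1 / T) := fun T hT => by
    rw [(hpair T hT).2.1, geoD_age_eq hT]
  have hPA : ∀ T, 2 ≤ T → avgPAoI (P T) (geoD (X T) T) δ₀ =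
      T * (scaledPeak ((1 - 1 / (T : ℝ)) ^ T) ((1 - 1 / (T : ℝ)) ^ (T - 1)) (1 / T) /
        periodCount ((1 - 1 / (T : ℝ)) ^ T) ((1 - 1 / (T : ℝ)) ^ (T - 1)) (1 / T)) := fun T hT => by
    rw [(hpair T hT).2.2, geoD_peak_eq hT rfl, geoD_count_eq hT rfl, mul_div_assoc]
  have hgeoT : ∀ T : ℕ, 2 / (1 / (T : ℝ)) = T * 2 := fun T => by rw [div_div_eq_mul_div]; ring
  have he := Real.exp_pos 1
  -- The peak limit is the same for both sensors, as `2 * T` is the average peak of each of them.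
  have hpeak : Tendsto (fun T : ℕ => reductionRatio 2
      (scaledPeak ((1 - 1 / (T : ℝ)) ^ T) ((1 - 1 / (T : ℝ)) ^ (T - 1)) (1 / T) /
        periodCount ((1 - 1 / (T : ℝ)) ^ T) ((1 - 1 / (T : ℝ)) ^ (T - 1)) (1 / T))) atTop
      (𝓝 ((3 * Real.exp 1 - 2) / (2 * (Real.exp 1 ^ 2 + Real.exp 1 + 1)))) := by
    convert tendsto_reductionRatio tendsto_const_nhds tendsto_scaledPeak_div_periodCount
      (two_ne_zero) using 2
    have h0 : periodCount (Real.exp 1)⁻¹ (Real.exp 1)⁻¹ 0 =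
        (Real.exp 1 ^ 2 + Real.exp 1 + 1) / Real.exp 1 ^ 2 := by
      unfold periodCount; field_simp; ring
    have h1 : scaledPeak (Real.exp 1)⁻¹ (Real.exp 1)⁻¹ 0 =
        (2 * Real.exp 1 ^ 2 - Real.exp 1 + 4) / Real.exp 1 ^ 2 := by
      unfold scaledPeak; field_simp; ring
    rw [h0, h1, reductionRatio]
    field_simp
    ring
  refine ⟨fun T hT => ⟨(hpair T hT).1, (hgeo T hT).1, (hdet T hT).1⟩, ?_, ?_, ?_, ?_,
    abs_sub_lt_of_exp_one_bounds⟩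
  · have h := tendsto_reductionRatio (tendsto_const_nhds (x := (2 : ℝ))) tendsto_scaledAge
      two_ne_zero
    refine (h.congr' ?_).trans (le_of_eq (congrArg 𝓝 ?_))
    · filter_upwards [eventually_ge_atTop 2] with T hT
      rw [(hgeo T hT).2.1, hA T hT, hgeoT, reductionRatio_mul_left (hne T hT)]
    · unfold reductionRatio scaledAge
      field_simp
      ring
  · have h32 : Tendsto (fun T : ℕ => (3 + 1 / (T : ℝ)) / 2) atTop (𝓝 ((3 + 0) / 2)) :=
      (tendsto_one_div_atTop_nhds_zero_nat.const_add 3).div_const 2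
    have h := tendsto_reductionRatio h32 tendsto_scaledAge (by norm_num)
    refine (h.congr' ?_).trans (le_of_eq (congrArg 𝓝 ?_))
    · filter_upwards [eventually_ge_atTop 2] with T hT
      have hT0 := hne T hT
      have e1 : (3 * (T : ℝ) + 1) / 2 = T * ((3 + 1 / T) / 2) := by field_simp
      rw [(hdet T hT).2.1, hA T hT, e1, reductionRatio_mul_left hT0]
    · unfold reductionRatio scaledAge
      field_simp
      ring
  · refine hpeak.congr' ?_
    filter_upwards [eventually_ge_atTop 2] with T hT
    rw [(hgeo T hT).2.2, hPA T hT, hgeoT, reductionRatio_mul_left (hne T hT)]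
  · refine hpeak.congr' ?_
    filter_upwards [eventually_ge_atTop 2] with T hT
    rw [(hdet T hT).2.2, hPA T hT, mul_comm 2, reductionRatio_mul_left (hne T hT)]
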